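/- **Conventions.** For a symmetric monoidal category write $I$ for the unit, $ac_{X,Y,Z}:X\otimes(Y\otimes Z)\to(X\otimes Y)\otimes Z$, $l_X:I\otimes X\to X$, $r_X:X\otimes I\to X$, $s_{X,Y}:X\otimes Y\to Y\otimes X$ for its canonical isomorphisms. A *symmetric monoidal functor* $F=(F,F^0,F^2)$ is a lax one: $F^0:I\to F(I)$ and natural $F^2_{X,Y}:F(X)\otimes F(Y)\to F(X\otimes Y)$, not required to be invertible, satisfy the usual associativity, unit and symmetry axioms; it is *strict* if $F^0$ and all $F^2_{X,Y}$ are identities. 2-cells are monoidal natural transformations. The composite $GF$ has $(GF)^0=G(F^0)\circ G^0$ and $(GF)^2_{X,Y}=G(F^2_{X,Y})\circ G^2_{FX,FY}$. $SMC(\mathcal C,\mathcal D)$ is the category of symmetric monoidal functors $\mathcal C\to\mathcal D$ and monoidal transformations, and $StrSMC(\mathcal C,\mathcal D)$ is its full subcategory of strict functors. **Internal hom.** $[\mathcal B,\mathcal C]$ is the category $SMC(\mathcal B,\mathcal C)$ with the pointwise symmetric monoidal structure: $(F\Box G)(b)=F(b)\otimes G(b)$, where $(F\Box G)^0$ is $I\cong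 I\otimes I\xrightarrow{F^0\otimes G^0}F(I)\otimes G(I)$ and $(F\Box G)^2_{b,b'}$ is the canonical isomorphism $(Fb\otimes Gb)\otimes(Fb'\otimes Gb')\cong(Fb\otimes Fb')\otimes(Gb\otimes Gb')$ followed by $F^2_{b,b'}\otimes G^2_{b,b'}$; the unit is the functor constant at $I$; the canonical isomorphisms are those of $\mathcal C$, pointwise. A symmetric monoidal $G:\mathcal D\to\mathcal C$ induces a symmetric monoidal functor $[\mathcal B,G]:[\mathcal B,\mathcal D]\to[\mathcal B,\mathcal C]$, $H\mapsto GH$, with $[\mathcal B,G]^0_b=G^0$ and $([\mathcal B,G]^2_{H,K})_b=G^2_{Hb,Kb}$; a 2-cell $\tau:G\to G'$ induces the 2-cell $[\mathcal B,\tau]:[\mathcal B,G]\to[\mathcal B,G']$ with $[\mathcal B,\tau]_H=\tau*H$. **Tensor.** Let $\mathcal A,\mathcal B$ be symmetric monoidal categories. The objects of $\mathcal A\otimes\mathcal B$ are the formal terms built from a constant $I$ and the pairs $a\otimes b$ ($a\in\mathcal A$, $b\in\mathcal B$) with a formal binary operation $\otimes$. Let $\mathcal H$ be the graph on these objects with the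 edges - $ac_{X,Y,Z}:X\otimes(Y\otimes Z)\to(X\otimes Y)\otimes Z$, $l_X:I\otimes X\to X$, $r_X:X\otimes I\to X$, edges $\overline{ac}_{X,Y,Z},\bar l_X,\bar r_X$ in the opposite directions, and $s_{X,Y}:X\otimes Y\to Y\otimes X$; - $\alpha_b:I\to I_{\mathcal A}\otimes b$, $\beta_a:I\to a\otimes I_{\mathcal B}$, $\gamma_{a,a',b}:(a\otimes b)\otimes(a'\otimes b)\to(a\otimes a')\otimes b$, $\delta_{a,b,b'}:(a\otimes b)\otimes(a\otimes b')\to a\otimes(b\otimes b')$; - $a\otimes g:a\otimes b\to a\otimes b'$ for $g:b\to b'$ in $\mathcal B$, and $f\otimes b:a\otimes b\to a'\otimes b$ for $f:a\to a'$ in $\mathcal A$; - inductively, $X\otimes p$ and $p\otimes X$ for every edge $p$ and object $X$. The category $\mathcal A\otimes\mathcal B$ is the quotient of the free category on $\mathcal H$ by the congruence generated by the closure under all $X\otimes-$ and $-\otimes X$ (acting edgewise on paths) of the following relations: 1. $(t\otimes W)\circ(X\otimes s)\sim(Y\otimes s)\circ(t\otimes Z)$ for edges $t:X\to Y$, $s:Z\to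 W$; 2. $ac,\overline{ac}$ are mutually inverse, so are $l,\bar l$ and $r,\bar r$, and $s_{Y,X}\circ s_{X,Y}\sim1$; 3. the coherence conditions of a symmetric monoidal category for $ac,l,r,s$: pentagon, triangle $(r_X\otimes Y)\circ ac_{X,I,Y}\sim X\otimes l_Y$, $l_X\circ s_{X,I}\sim r_X$, and the hexagon $ac_{Z,X,Y}\circ s_{X\otimes Y,Z}\circ ac_{X,Y,Z}\sim(s_{X,Z}\otimes Y)\circ ac_{X,Z,Y}\circ(X\otimes s_{Y,Z})$; 4. naturality of $ac,l,r,s$ in each variable with respect to the edges of $\mathcal H$; 5. $a\otimes(g'\circ g)\sim(a\otimes g')\circ(a\otimes g)$, $(f'\circ f)\otimes b\sim(f'\otimes b)\circ(f\otimes b)$, $a\otimes1_b\sim1$, $1_a\otimes b\sim1$, and $(a'\otimes g)\circ(f\otimes b)\sim(f\otimes b')\circ(a\otimes g)$; 6. naturality of $\alpha_b,\beta_a,\gamma_{a,a',b},\delta_{a,b,b'}$ in each of their variables; 7. for each $a$, the associativity, left and right unit and symmetry axioms stating that $\beta_a$ and $\delta_{a,-,-}$ make $a\otimes-$ a symmetric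 monoidal functor $\mathcal B\to\mathcal A\otimes\mathcal B$; 8. for each $b$, the same axioms for $-\otimes b$ with $\alpha_b$ and $\gamma_{-,-,b}$; 9. $\delta_{I_{\mathcal A},b,b'}\circ(\alpha_b\otimes\alpha_{b'})\sim\alpha_{b\otimes b'}\circ l_I$, $\ \gamma_{a,a',I_{\mathcal B}}\circ(\beta_a\otimes\beta_{a'})\sim\beta_{a\otimes a'}\circ l_I$, $\ \beta_{I_{\mathcal A}}\sim\alpha_{I_{\mathcal B}}$, and $\gamma_{a,a',b\otimes b'}\circ(\delta_{a,b,b'}\otimes\delta_{a',b,b'})\sim\delta_{a\otimes a',b,b'}\circ(\gamma_{a,a',b}\otimes\gamma_{a,a',b'})\circ m$, where $m$ is the canonical isomorphism exchanging the two middle factors. It is symmetric monoidal with $\otimes$, $I$, $ac$, $l$, $r$, $s$. There is a symmetric monoidal functor $\eta:\mathcal A\to[\mathcal B,\mathcal A\otimes\mathcal B]$ given by $\eta(a)(b)=a\otimes b$, $\eta(a)(g)=a\otimes g$, $\eta(a)^0=\beta_a$, $\eta(a)^2_{b,b'}=\delta_{a,b,b'}$, $\eta(f)_b=f\otimes b$,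 $(\eta^0)_b=\alpha_b$, $(\eta^2_{a,a'})_b=\gamma_{a,a',b}$. **The assignments $\overline{(-)}$.** For a symmetric monoidal functor $F:\mathcal A\to[\mathcal B,\mathcal C]$, let $En(F)=\bar F:\mathcal A\otimes\mathcal B\to\mathcal C$ be the strict symmetric monoidal functor with $\bar F(I)=I$, $\bar F(a\otimes b)=F(a)(b)$, $\bar F(X\otimes Y)=\bar F(X)\otimes\bar F(Y)$ on objects, and given on edges by: canonical edges go to the corresponding canonical isomorphisms of $\mathcal C$, $\alpha_b\mapsto(F^0)_b$, $\beta_a\mapsto F(a)^0$, $\gamma_{a,a',b}\mapsto(F^2_{a,a'})_b$, $\delta_{a,b,b'}\mapsto F(a)^2_{b,b'}$, $a\otimes g\mapsto F(a)(g)$, $f\otimes b\mapsto F(f)_b$, $X\otimes p\mapsto\bar F(X)\otimes\bar F(p)$, $p\otimes X\mapsto\bar F(p)\otimes\bar F(X)$. For a 2-cell $\sigma:F\to G$ let $En(\sigma)=\bar\sigma:\bar F\to\bar G$ be the monoidal transformation with $\bar\sigma_I=1$, $\bar\sigma_{a\otimes b}=(\sigma_a)_b$, $\bar\sigma_{X\otimes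 Y}=\bar\sigma_X\otimes\bar\sigma_Y$. **Statement.** Let $\mathcal A,\mathcal B,\mathcal C$ be symmetric monoidal categories. 1. For every symmetric monoidal functor $F:\mathcal A\to[\mathcal B,\mathcal C]$, $\bar F$ is strict, $[\mathcal B,\bar F]\circ\eta=F$ as symmetric monoidal functors, and every strict symmetric monoidal functor $K:\mathcal A\otimes\mathcal B\to\mathcal C$ with $[\mathcal B,K]\circ\eta=F$ equals $\bar F$. 2. For every monoidal transformation $\sigma:F\to G$ between symmetric monoidal functors $\mathcal A\to[\mathcal B,\mathcal C]$, a monoidal transformation $\tau:\bar F\to\bar G$ satisfies $[\mathcal B,\tau]*\eta=\sigma$ if and only if $\tau=\bar\sigma$. 3. The assignments $F\mapsto\bar F$, $\sigma\mapsto\bar\sigma$ define a functor $En:SMC(\mathcal A,[\mathcal B,\mathcal C])\to SMC(\mathcal A\otimes\mathcal B,\mathcal C)$, which factors as an isomorphism of categories $SMC(\mathcal A,[\mathcal B,\mathcal C])\cong StrSMC(\mathcal A\otimes\mathcal B,\mathcal C)$ followed by the inclusion $StrSMC(\mathcal A\otimes\mathcal B,\mathcal C)\to SMC(\mathcal A\otimes\mathcal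 B,\mathcal C)$. -/

import Mathlib

open CategoryTheory MonoidalCategory

universe v₁ v₂ v₃ v₄ u₁ u₂ u₃ u₄

namespace SMC

section Aux

variable {D : Type u₂} [Category.{v₂} D] [MonoidalCategory D]

lemma comp_tensorHom_left {X X' Y Z W : D} (s : X ⟶ X') (f : X' ⟶ Y) (g : Z ⟶ W) :
    (s ≫ f) ⊗ₘ g = s ▷ Z ≫ (f ⊗ₘ g) := by
  rw [← tensorHom_id, tensorHom_comp_tensorHom, Category.id_comp]

lemma comp_tensorHom_right {X X' Y Z W : D} (s : X ⟶ X') (f : X' ⟶ Y) (g : Z ⟶ W) :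
    g ⊗ₘ (s ≫ f) = Z ◁ s ≫ (g ⊗ₘ f) := by
  rw [← id_tensorHom, tensorHom_comp_tensorHom, Category.id_comp]

lemma comp_eq_of_inv_comp_comp {D : Type u₂} [Category.{v₂} D] {X Y Z W : D} (i : X ≅ Y)
    {f : X ⟶ Z} {g : Z ⟶ W} {h : Y ⟶ W}
    (e : (i.inv ≫ f) ≫ g = h) : f ≫ g = i.hom ≫ h := by
  rw [← e, Category.assoc, Iso.hom_inv_id_assoc]

lemma strict_assoc {X Y Z : D} {f : (X ⊗ Y) ⊗ Z ⟶ X ⊗ (Y ⊗ Z)} (h : f = (α_ X Y Z).hom) :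
    𝟙 (X ⊗ Y) ▷ Z ≫ 𝟙 _ ≫ f = (α_ X Y Z).hom ≫ X ◁ 𝟙 (Y ⊗ Z) ≫ 𝟙 _ := by
  simp [h]

lemma strict_left {X : D} {f : 𝟙_ D ⊗ X ⟶ X} (h : f = (λ_ X).hom) :
    (λ_ X).hom = 𝟙 (𝟙_ D) ▷ X ≫ 𝟙 _ ≫ f := by
  simp [h]

lemma strict_right {X : D} {f : X ⊗ 𝟙_ D ⟶ X} (h : f = (ρ_ X).hom) :
    (ρ_ X).hom = X ◁ 𝟙 (𝟙_ D) ≫ 𝟙 _ ≫ f := by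
  simp [h]

variable [SymmetricCategory D]

lemma tensorμ_comp_braiding (X₁ X₂ Y₁ Y₂ : D) :
    tensorμ X₁ X₂ Y₁ Y₂ ≫ (β_ (X₁ ⊗ Y₁) (X₂ ⊗ Y₂)).hom =
      ((β_ X₁ X₂).hom ⊗ₘ (β_ Y₁ Y₂).hom) ≫ tensorμ X₂ X₁ Y₂ Y₁ := by
  simp [tensorμ, SymmetricCategory.braiding_swap_eq_inv_braiding Y₁ X₂,
    MonoidalCategory.tensorHom_def]

lemma tensorμ_tensorμ (X₁ X₂ Y₁ Y₂ : D) :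
    tensorμ X₁ X₂ Y₁ Y₂ ≫ tensorμ X₁ Y₁ X₂ Y₂ = 𝟙 _ := by
  have : tensorμ X₁ Y₁ X₂ Y₂ = tensorδ X₁ X₂ Y₁ Y₂ := by
    simp [tensorμ, tensorδ, SymmetricCategory.braiding_swap_eq_inv_braiding X₂ Y₁]
  rw [this, tensorμ_tensorδ]

lemma tensorμ_comp_braiding_tensor (X₁ X₂ Y₁ Y₂ : D) :
    tensorμ X₁ X₂ Y₁ Y₂ ≫ ((β_ X₁ Y₁).hom ⊗ₘ (β_ X₂ Y₂).hom) =
      (β_ (X₁ ⊗ X₂) (Y₁ ⊗ Y₂)).hom ≫ tensorμ Y₁ Y₂ X₁ X₂ := by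
  have h := tensorμ_comp_braiding X₁ Y₁ X₂ Y₂
  have h2 := congrArg (fun t => tensorμ X₁ X₂ Y₁ Y₂ ≫ t ≫ tensorμ Y₁ Y₂ X₁ X₂) h
  simp only [Category.assoc, tensorμ_tensorμ, Category.comp_id] at h2
  rw [← Category.assoc (tensorμ X₁ X₂ Y₁ Y₂) (tensorμ _ _ _ _), tensorμ_tensorμ,
    Category.id_comp] at h2
  exact h2.symm

lemma comp_eq_of_tensorμ_comp_comp {X₁ X₂ Y₁ Y₂ Z W V : D} {f : (X₁ ⊗ Y₁) ⊗ (X₂ ⊗ Y₂) ⟶ Z}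
    {g : Z ⟶ W} {k : (X₁ ⊗ X₂) ⊗ (Y₁ ⊗ Y₂) ⟶ V} {l : V ⟶ W}
    (e : (tensorμ X₁ X₂ Y₁ Y₂ ≫ f) ≫ g = k ≫ l) :
    f ≫ g = (α_ X₁ Y₁ (X₂ ⊗ Y₂)).hom ≫ X₁ ◁ (α_ Y₁ X₂ Y₂).inv ≫ X₁ ◁ (β_ Y₁ X₂).hom ▷ Y₂ ≫
      X₁ ◁ (α_ X₂ Y₁ Y₂).hom ≫ (α_ X₁ X₂ (Y₁ ⊗ Y₂)).inv ≫ k ≫ l := by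
  have h : f ≫ g = tensorμ X₁ Y₁ X₂ Y₂ ≫ k ≫ l := by
    rw [← e, Category.assoc, ← Category.assoc, tensorμ_tensorμ, Category.id_comp]
  rw [h]
  simp only [tensorμ, Category.assoc]

lemma strict_braided {X Y : D} {f : X ⊗ Y ⟶ Y ⊗ X} (h : f = (β_ X Y).hom) :
    𝟙 _ ≫ f = (β_ X Y).hom ≫ 𝟙 _ := by
  simp [h]

end Aux

section Hom

variable {C : Type u₁} [Category.{v₁} C] [MonoidalCategory C] [SymmetricCategory C]
  {D : Type u₂} [Category.{v₂} D] [MonoidalCategory D] [SymmetricCategory D]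
  {E : Type u₃} [Category.{v₃} E] [MonoidalCategory E] [SymmetricCategory E]

open Functor.LaxMonoidal

/-- The natural transformation underlying a monoidal transformation. -/
abbrev nat {F G : LaxBraidedFunctor C D} (σ : F ⟶ G) : F.toFunctor ⟶ G.toFunctor := σ.hom.hom

instance {F G : LaxBraidedFunctor C D} (σ : F ⟶ G) : NatTrans.IsMonoidal (nat σ) :=
  σ.hom.isMonoidal

/-- The pointwise tensor `F □ G` of two symmetric monoidal functors: `X ↦ F X ⊗ G X`, with unit
structure `I ≅ I ⊗ I ⟶ F I ⊗ G I` and tensor structure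
`(F X ⊗ G X) ⊗ (F Y ⊗ G Y) ≅ (F X ⊗ F Y) ⊗ (G X ⊗ G Y) ⟶ F (X ⊗ Y) ⊗ G (X ⊗ Y)`. -/
def box (F G : LaxBraidedFunctor C D) : LaxBraidedFunctor C D where
  toFunctor := F.toFunctor.prod' G.toFunctor ⋙ tensor D
  laxBraided :=
    { __ := (inferInstance : (F.toFunctor.prod' G.toFunctor ⋙ tensor D).LaxMonoidal).copy
        ((λ_ (𝟙_ D)).inv ≫ (ε F.toFunctor ⊗ₘ ε G.toFunctor))
        (fun X Y => tensorμ (F.obj X) (G.obj X) (F.obj Y) (G.obj Y) ≫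
          (μ F.toFunctor X Y ⊗ₘ μ G.toFunctor X Y))
        (by simp) (by ext X Y; simp)
      braided := by
        intro X Y
        have h1 := Functor.LaxBraided.braided (F := F.toFunctor) X Y
        have h2 := Functor.LaxBraided.braided (F := G.toFunctor) X Y
        have h3 := tensorμ_comp_braiding_tensor (F.obj X) (G.obj X) (F.obj Y) (G.obj Y)
        have h4 := congrArg (fun t => t ≫ (μ F.toFunctor Y X ⊗ₘ μ G.toFunctor Y X)) h3
        change (tensorμ (F.obj X) (G.obj X) (F.obj Y) (G.obj Y) ≫
          (μ F.toFunctor X Y ⊗ₘ μ G.toFunctor X Y)) ≫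
            (F.map (β_ X Y).hom ⊗ₘ G.map (β_ X Y).hom) = _ ≫ tensorμ _ _ _ _ ≫
              (μ F.toFunctor Y X ⊗ₘ μ G.toFunctor Y X)
        simpa [h1, h2, -BraidedCategory.braiding_tensor_left_hom,
          -BraidedCategory.braiding_tensor_right_hom] using h4 }

@[simp] lemma box_obj (F G : LaxBraidedFunctor C D) (X : C) :
    (box F G).obj X = F.obj X ⊗ G.obj X := rfl
@[simp] lemma box_map (F G : LaxBraidedFunctor C D) {X Y : C} (f : X ⟶ Y) :
    (box F G).map f = F.map f ⊗ₘ G.map f := rfl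
@[simp] lemma box_ε (F G : LaxBraidedFunctor C D) :
    ε (box F G).toFunctor = (λ_ (𝟙_ D)).inv ≫ (ε F.toFunctor ⊗ₘ ε G.toFunctor) := rfl
@[simp] lemma box_μ (F G : LaxBraidedFunctor C D) (X Y : C) :
    μ (box F G).toFunctor X Y = tensorμ (F.obj X) (G.obj X) (F.obj Y) (G.obj Y) ≫
      (μ F.toFunctor X Y ⊗ₘ μ G.toFunctor X Y) := rfl

/-- The unit of the internal hom: the functor constant at the unit object, with the identity and
`I ⊗ I ≅ I` as its monoidal structure. -/
def homUnit : LaxBraidedFunctor C D where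
  toFunctor := (Functor.const C).obj (𝟙_ D)
  laxBraided :=
    { ε := 𝟙 _
      μ := fun _ _ => (λ_ (𝟙_ D)).hom
      braided := by
        intro X Y
        simp [← unitors_equal]
      left_unitality := by intro X; simp
      right_unitality := by intro X; simp [unitors_equal]
      associativity := by
        intro X Y Z
        simp only [Functor.const_obj_obj, Functor.const_obj_map, Category.comp_id]
        monoidal }

@[simp] lemma homUnit_obj (X : C) : (homUnit : LaxBraidedFunctor C D).obj X = 𝟙_ D := rfl
@[simp] lemma homUnit_map {X Y : C} (f : X ⟶ Y) :
    (homUnit : LaxBraidedFunctor C D).map f = 𝟙 (𝟙_ D) := rfl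
@[simp] lemma homUnit_ε : ε (homUnit : LaxBraidedFunctor C D).toFunctor = 𝟙 (𝟙_ D) := rfl
@[simp] lemma homUnit_μ (X Y : C) :
    μ (homUnit : LaxBraidedFunctor C D).toFunctor X Y = (λ_ (𝟙_ D)).hom := rfl

/-- A monoidal transformation from its components. -/
abbrev mkHom {F G : LaxBraidedFunctor C D} (app : ∀ X, F.obj X ⟶ G.obj X)
    (nat : ∀ {X Y : C} (f : X ⟶ Y), F.map f ≫ app Y = app X ≫ G.map f)
    (unit : ε F.toFunctor ≫ app (𝟙_ C) = ε G.toFunctor)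
    (tensor : ∀ X Y, μ F.toFunctor X Y ≫ app (X ⊗ Y) = (app X ⊗ₘ app Y) ≫ μ G.toFunctor X Y) :
    F ⟶ G :=
  @LaxBraidedFunctor.homMk _ _ _ _ _ _ _ _ F G ⟨app, @nat⟩ ⟨unit, tensor⟩

lemma hom_ext_app {F G : LaxBraidedFunctor C D} {σ τ : F ⟶ G}
    (h : ∀ X, (nat σ).app X = (nat τ).app X) : σ = τ :=
  LaxBraidedFunctor.hom_ext (NatTrans.ext (funext h))

lemma hom_naturality {F G : LaxBraidedFunctor C D} (σ : F ⟶ G) {X Y : C} (f : X ⟶ Y) :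
    F.map f ≫ (nat σ).app Y = (nat σ).app X ≫ G.map f := (nat σ).naturality f

lemma hom_unit {F G : LaxBraidedFunctor C D} (σ : F ⟶ G) :
    ε F.toFunctor ≫ (nat σ).app (𝟙_ C) = ε G.toFunctor :=
  NatTrans.IsMonoidal.unit (τ := nat σ)

lemma hom_tensor {F G : LaxBraidedFunctor C D} (σ : F ⟶ G) (X Y : C) :
    μ F.toFunctor X Y ≫ (nat σ).app (X ⊗ Y) =
      ((nat σ).app X ⊗ₘ (nat σ).app Y) ≫ μ G.toFunctor X Y :=
  NatTrans.IsMonoidal.tensor (τ := nat σ) X Y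

/-- A monoidal transformation with its components replaced by equal ones. -/
def copyApp {F G : LaxBraidedFunctor C D} (σ : F ⟶ G) (app : ∀ X, F.obj X ⟶ G.obj X)
    (h : ∀ X, app X = (nat σ).app X) : F ⟶ G :=
  mkHom app (fun f => by rw [h, h, hom_naturality]) (by rw [h, hom_unit])
    (fun X Y => by rw [h, h, h, hom_tensor])

/-- The pointwise tensor of two monoidal transformations. -/
def boxMap {F G F' G' : LaxBraidedFunctor C D} (σ : F ⟶ G) (τ : F' ⟶ G') :
    box F F' ⟶ box G G' :=
  mkHom (fun X => (nat σ).app X ⊗ₘ (nat τ).app X)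
    (by intro X Y f; simp [hom_naturality, -NatTrans.naturality])
    (by simp)
    (by
      intro X Y
      have := tensorμ_natural ((nat σ).app X) ((nat τ).app X) ((nat σ).app Y) ((nat τ).app Y)
      have h2 := congrArg (fun t => t ≫ (μ G.toFunctor X Y ⊗ₘ μ G'.toFunctor X Y)) this
      simpa [hom_tensor, -associator_conjugation] using h2.symm)

/-- The internal hom `[C, D]` has as underlying category that of (lax) symmetric monoidal functors
`C ⥤ D` and monoidal transformations; its tensor, unit, associativity, units and symmetry are
computed pointwise in `D`. -/
instance : MonoidalCategoryStruct (LaxBraidedFunctor C D) where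
  tensorObj := box
  tensorHom σ τ := boxMap σ τ
  whiskerLeft F _ _ τ := copyApp (boxMap (𝟙 F) τ) (fun X => F.obj X ◁ (nat τ).app X)
    fun _ => (id_tensorHom _ _).symm
  whiskerRight σ F := copyApp (boxMap σ (𝟙 F)) (fun X => (nat σ).app X ▷ F.obj X)
    fun _ => (tensorHom_id _ _).symm
  tensorUnit := homUnit
  associator F G H := LaxBraidedFunctor.isoOfComponents
    (fun X => α_ (F.obj X) (G.obj X) (H.obj X))
    (by intro X Y f; simp)
    (by
      have h : (λ_ (𝟙_ D)).inv ≫ (λ_ (𝟙_ D)).inv ▷ 𝟙_ D ≫ (α_ (𝟙_ D) (𝟙_ D) (𝟙_ D)).hom =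
        (λ_ (𝟙_ D)).inv ≫ 𝟙_ D ◁ (λ_ (𝟙_ D)).inv := by monoidal
      simp only [box_obj, box_ε]
      rw [comp_tensorHom_left, comp_tensorHom_right, Category.assoc, Category.assoc,
        associator_naturality, reassoc_of% h])
    (by
      intro X Y
      have h := associator_monoidal (F.obj X) (G.obj X) (H.obj X) (F.obj Y) (G.obj Y) (H.obj Y)
      simp only [box_obj, box_μ]
      rw [comp_tensorHom_left, comp_tensorHom_right, Category.assoc, Category.assoc,
        associator_naturality, reassoc_of% h])
  leftUnitor F := LaxBraidedFunctor.isoOfComponents (fun X => λ_ (F.obj X))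
    (by intro X Y f; simp)
    (by simp [MonoidalCategory.tensorHom_def'])
    (by
      intro X Y
      have := leftUnitor_monoidal (F.obj X) (F.obj Y)
      simp only [box_obj, box_μ, homUnit_obj, homUnit_μ, Category.assoc]
      rw [this]
      simp [MonoidalCategory.tensorHom_def])
  rightUnitor F := LaxBraidedFunctor.isoOfComponents (fun X => ρ_ (F.obj X))
    (by intro X Y f; simp)
    (by simp [unitors_inv_equal, MonoidalCategory.tensorHom_def])
    (by
      intro X Y
      have := rightUnitor_monoidal (F.obj X) (F.obj Y)
      simp only [box_obj, box_μ, homUnit_obj, homUnit_μ, Category.assoc]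
      rw [this]
      simp [MonoidalCategory.tensorHom_def'])


instance : MonoidalCategory (LaxBraidedFunctor C D) where
  tensorHom_def σ τ := hom_ext_app fun X =>
    MonoidalCategory.tensorHom_def ((nat σ).app X) ((nat τ).app X)
  id_tensorHom_id F G := hom_ext_app fun X => id_tensorHom_id (F.obj X) (G.obj X)
  tensorHom_comp_tensorHom σ τ σ' τ' := hom_ext_app fun X =>
    tensorHom_comp_tensorHom ((nat σ).app X) ((nat τ).app X) ((nat σ').app X) ((nat τ').app X)
  whiskerLeft_id F G := hom_ext_app fun X => whiskerLeft_id (F.obj X) (G.obj X)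
  id_whiskerRight F G := hom_ext_app fun X => id_whiskerRight (F.obj X) (G.obj X)
  associator_naturality σ τ υ := hom_ext_app fun X =>
    associator_naturality ((nat σ).app X) ((nat τ).app X) ((nat υ).app X)
  leftUnitor_naturality σ := hom_ext_app fun X => leftUnitor_naturality ((nat σ).app X)
  rightUnitor_naturality σ := hom_ext_app fun X => rightUnitor_naturality ((nat σ).app X)
  pentagon F G H K := hom_ext_app fun X => pentagon (F.obj X) (G.obj X) (H.obj X) (K.obj X)
  triangle F G := hom_ext_app fun X => triangle (F.obj X) (G.obj X)

lemma box_unit_braiding (F G : LaxBraidedFunctor C D) :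
    ε (box F G).toFunctor ≫ (β_ (F.obj (𝟙_ C)) (G.obj (𝟙_ C))).hom = ε (box G F).toFunctor := by
  change ((λ_ (𝟙_ D)).inv ≫ (ε F.toFunctor ⊗ₘ ε G.toFunctor)) ≫ (β_ (F.obj _) (G.obj _)).hom =
    (λ_ (𝟙_ D)).inv ≫ (ε G.toFunctor ⊗ₘ ε F.toFunctor)
  rw [Category.assoc, BraidedCategory.braiding_naturality]
  simp
  rw [← unitors_equal, Iso.hom_inv_id_assoc]

instance : SymmetricCategory (LaxBraidedFunctor C D) where
  braiding F G := LaxBraidedFunctor.isoOfComponents (fun X => β_ (F.obj X) (G.obj X))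
    (fun f => BraidedCategory.braiding_naturality (F.map f) (G.map f))
    (box_unit_braiding F G)
    (fun X Y => by
      have h := tensorμ_comp_braiding (F.obj X) (G.obj X) (F.obj Y) (G.obj Y)
      change (tensorμ _ _ _ _ ≫ (μ F.toFunctor X Y ⊗ₘ μ G.toFunctor X Y)) ≫
        (β_ (F.obj _) (G.obj _)).hom = _ ≫ tensorμ _ _ _ _ ≫
          (μ G.toFunctor X Y ⊗ₘ μ F.toFunctor X Y)
      rw [Category.assoc, BraidedCategory.braiding_naturality]
      exact (reassoc_of% h) _)
  braiding_naturality_right F _ _ τ := hom_ext_app fun X =>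
    BraidedCategory.braiding_naturality_right (F.obj X) ((nat τ).app X)
  braiding_naturality_left σ H := hom_ext_app fun X =>
    BraidedCategory.braiding_naturality_left ((nat σ).app X) (H.obj X)
  hexagon_forward F G H := hom_ext_app fun X =>
    BraidedCategory.hexagon_forward (F.obj X) (G.obj X) (H.obj X)
  hexagon_reverse F G H := hom_ext_app fun X =>
    BraidedCategory.hexagon_reverse (F.obj X) (G.obj X) (H.obj X)
  symmetry F G := hom_ext_app fun X => SymmetricCategory.symmetry (F.obj X) (G.obj X)

/-- The composite `G ∘ F` of symmetric monoidal functors, written in the order of the diagram.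
Its structure arrows are `G(F⁰) ∘ G⁰` and `G(F²) ∘ G²`. -/
def compSMC (F : LaxBraidedFunctor C D) (G : LaxBraidedFunctor D E) : LaxBraidedFunctor C E :=
  .of (F.toFunctor ⋙ G.toFunctor)

/-- The horizontal composite `G * σ : G ∘ F ⟶ G ∘ F'`. -/
def whiskerRightSMC {F F' : LaxBraidedFunctor C D} (σ : F ⟶ F') (G : LaxBraidedFunctor D E) :
    compSMC F G ⟶ compSMC F' G :=
  @LaxBraidedFunctor.homMk _ _ _ _ _ _ _ _ (compSMC F G) (compSMC F' G)
    (Functor.whiskerRight (nat σ) G.toFunctor)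
    (inferInstanceAs (NatTrans.IsMonoidal (Functor.whiskerRight (nat σ) G.toFunctor)))

/-- The horizontal composite `σ * F : G ∘ F ⟶ G' ∘ F`. -/
def whiskerLeftSMC (F : LaxBraidedFunctor C D) {G G' : LaxBraidedFunctor D E} (σ : G ⟶ G') :
    compSMC F G ⟶ compSMC F G' :=
  @LaxBraidedFunctor.homMk _ _ _ _ _ _ _ _ (compSMC F G) (compSMC F G')
    (Functor.whiskerLeft F.toFunctor (nat σ))
    (inferInstanceAs (NatTrans.IsMonoidal (Functor.whiskerLeft F.toFunctor (nat σ))))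

lemma post_unit_μ (G : LaxBraidedFunctor D E) :
    (λ_ (𝟙_ E)).hom ≫ ε G.toFunctor =
      (ε G.toFunctor ⊗ₘ ε G.toFunctor) ≫ μ G.toFunctor (𝟙_ D) (𝟙_ D) ≫ G.map (λ_ (𝟙_ D)).hom := by
  rw [ε_tensorHom_comp_μ_assoc, ← Functor.map_comp, Iso.inv_hom_id, CategoryTheory.Functor.map_id,
    Category.comp_id, leftUnitor_naturality]

/-- The symmetric monoidal functor `[B, G] : [B, D] ⥤ [B, E]`, `H ↦ G ∘ H`, whose structure arrows
have the components `G⁰ : I ⟶ G I` and `G² : G (H b) ⊗ G (K b) ⟶ G (H b ⊗ K b)`. -/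
def post (B : Type u₁) [Category.{v₁} B] [MonoidalCategory B] [SymmetricCategory B]
    (G : LaxBraidedFunctor D E) :
    LaxBraidedFunctor (LaxBraidedFunctor B D) (LaxBraidedFunctor B E) where
  toFunctor :=
    { obj := fun H => compSMC H G
      map := fun τ => whiskerRightSMC τ G
      map_id := fun H => hom_ext_app fun X => G.map_id (H.obj X)
      map_comp := fun σ τ => hom_ext_app fun X => G.map_comp ((nat σ).app X) ((nat τ).app X) }
  laxBraided :=
    { ε := @mkHom _ _ _ _ _ _ _ _ homUnit (compSMC homUnit G) (fun _ => ε G.toFunctor)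
        (fun _ => by
          change 𝟙 _ ≫ _ = _ ≫ G.map (𝟙 _)
          simp)
        (by
          change 𝟙 _ ≫ _ = _ ≫ G.map (𝟙 _)
          simp)
        (fun _ _ => by
          change (λ_ (𝟙_ E)).hom ≫ _ = _ ≫ μ G.toFunctor _ _ ≫ G.map (λ_ (𝟙_ D)).hom
          exact post_unit_μ G)
      μ := fun H K => @mkHom _ _ _ _ _ _ _ _ (box (compSMC H G) (compSMC K G))
        (compSMC (box H K) G) (fun X => μ G.toFunctor (H.obj X) (K.obj X))
        (fun f => μ_natural G.toFunctor (H.map f) (K.map f))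
        (by
          change ((λ_ (𝟙_ E)).inv ≫ ((ε G.toFunctor ≫ G.map (ε H.toFunctor)) ⊗ₘ
            (ε G.toFunctor ≫ G.map (ε K.toFunctor)))) ≫ μ G.toFunctor _ _ =
              ε G.toFunctor ≫ G.map ((λ_ (𝟙_ D)).inv ≫ (ε H.toFunctor ⊗ₘ ε K.toFunctor))
          rw [← tensorHom_comp_tensorHom, Category.assoc, Category.assoc, μ_natural,
            Functor.map_comp]
          have h2 := post_unit_μ G
          rw [← Iso.eq_inv_comp] at h2
          conv_rhs => rw [h2]
          simp only [Category.assoc]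
          rw [← Functor.map_comp_assoc, Iso.hom_inv_id, CategoryTheory.Functor.map_id,
            Category.id_comp])
        (fun X Y => by
          change (tensorμ _ _ _ _ ≫ ((μ G.toFunctor _ _ ≫ G.map (μ H.toFunctor X Y)) ⊗ₘ
            (μ G.toFunctor _ _ ≫ G.map (μ K.toFunctor X Y)))) ≫ μ G.toFunctor _ _ =
            (μ G.toFunctor _ _ ⊗ₘ μ G.toFunctor _ _) ≫ μ G.toFunctor _ _ ≫
              G.map (tensorμ _ _ _ _ ≫ (μ H.toFunctor X Y ⊗ₘ μ K.toFunctor X Y))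
          have h := tensorμ_comp_μ_tensorHom_μ_comp_μ G.toFunctor (H.obj X) (K.obj X)
            (H.obj Y) (K.obj Y)
          rw [← tensorHom_comp_tensorHom, Category.assoc, Category.assoc, μ_natural,
            Functor.map_comp, reassoc_of% h])
      μ_natural_left := fun σ K => hom_ext_app fun X =>
        μ_natural_left G.toFunctor ((nat σ).app X) (K.obj X)
      μ_natural_right := fun K σ => hom_ext_app fun X =>
        μ_natural_right G.toFunctor (K.obj X) ((nat σ).app X)
      associativity := fun H K L => hom_ext_app fun X =>
        associativity G.toFunctor (H.obj X) (K.obj X) (L.obj X)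
      left_unitality := fun H => hom_ext_app fun X => left_unitality G.toFunctor (H.obj X)
      right_unitality := fun H => hom_ext_app fun X => right_unitality G.toFunctor (H.obj X)
      braided := fun H K => hom_ext_app fun X =>
        Functor.LaxBraided.braided (F := G.toFunctor) (H.obj X) (K.obj X) }

/-- The monoidal transformation `[B, σ] : [B, G] ⟶ [B, G']` with component `σ * H` at `H`. -/
def postMap (B : Type u₁) [Category.{v₁} B] [MonoidalCategory B] [SymmetricCategory B]
    {G G' : LaxBraidedFunctor D E} (σ : G ⟶ G') : post B G ⟶ post B G' :=
  mkHom (fun H => whiskerLeftSMC H σ)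
    (fun τ => hom_ext_app fun X => hom_naturality σ ((nat τ).app X))
    (hom_ext_app fun _ => hom_unit σ)
    (fun H K => hom_ext_app fun X => hom_tensor σ (H.obj X) (K.obj X))

end Hom

section Tensor

/-- The objects of `A ⊗ B`: the terms built from a constant `I` and the pairs `(a, b)`, written
`a ⊗ b`, by a binary operation `⊗`. -/
inductive TensorObj (A : Type u₁) (B : Type u₂) : Type (max u₁ u₂)
  | unit : TensorObj A B
  | pair (a : A) (b : B) : TensorObj A B
  | tensor (X Y : TensorObj A B) : TensorObj A B

variable {A : Type u₁} [Category.{v₁} A] [MonoidalCategory A]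
  {B : Type u₂} [Category.{v₂} B] [MonoidalCategory B]

open TensorObj in
/-- The edges of the graph generating `A ⊗ B`: the canonical edges `ac`, `l`, `r`, their formal
inverses and the symmetries `s`; the edges `α_b`, `β_a`, `γ_{a,a',b}`, `δ_{a,b,b'}`; the edges
`right a g`, that is `a ⊗ g : a ⊗ b ⟶ a ⊗ b'`, and `left f b`, that is
`f ⊗ b : a ⊗ b ⟶ a' ⊗ b`; all of them closed under `X ⊗ -` and `- ⊗ X`. -/
inductive Edge : TensorObj A B → TensorObj A B → Type (max u₁ v₁ u₂ v₂)
  | ac (X Y Z : TensorObj A B) : Edge (tensor X (tensor Y Z)) (tensor (tensor X Y) Z)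
  | acInv (X Y Z : TensorObj A B) : Edge (tensor (tensor X Y) Z) (tensor X (tensor Y Z))
  | l (X : TensorObj A B) : Edge (tensor unit X) X
  | lInv (X : TensorObj A B) : Edge X (tensor unit X)
  | r (X : TensorObj A B) : Edge (tensor X unit) X
  | rInv (X : TensorObj A B) : Edge X (tensor X unit)
  | s (X Y : TensorObj A B) : Edge (tensor X Y) (tensor Y X)
  | alpha (b : B) : Edge unit (pair (𝟙_ A) b)
  | beta (a : A) : Edge unit (pair a (𝟙_ B))
  | gamma (a a' : A) (b : B) : Edge (tensor (pair a b) (pair a' b)) (pair (a ⊗ a') b)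
  | delta (a : A) (b b' : B) : Edge (tensor (pair a b) (pair a b')) (pair a (b ⊗ b'))
  | right (a : A) {b b' : B} (g : b ⟶ b') : Edge (pair a b) (pair a b')
  | left {a a' : A} (f : a ⟶ a') (b : B) : Edge (pair a b) (pair a' b)
  | whiskerLeft (X : TensorObj A B) {Y Z : TensorObj A B} (p : Edge Y Z) :
      Edge (tensor X Y) (tensor X Z)
  | whiskerRight {Y Z : TensorObj A B} (p : Edge Y Z) (X : TensorObj A B) :
      Edge (tensor Y X) (tensor Z X)

/-- The graph generating `A ⊗ B`. -/
abbrev edgeQuiver : Quiver (TensorObj A B) := ⟨Edge⟩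

/-- The free category on the graph: arrows are paths of consecutive edges. -/
instance : Category (TensorObj A B) where
  Hom X Y := @Quiver.Path _ edgeQuiver X Y
  id X := @Quiver.Path.nil _ edgeQuiver X
  comp p q := @Quiver.Path.comp _ edgeQuiver _ _ _ p q
  id_comp p := @Quiver.Path.nil_comp _ edgeQuiver _ _ p
  comp_id p := @Quiver.Path.comp_nil _ edgeQuiver _ _ p
  assoc p q r := @Quiver.Path.comp_assoc _ edgeQuiver _ _ _ _ p q r

/-- The path consisting of one edge. -/
def gen {X Y : TensorObj A B} (p : Edge X Y) : X ⟶ Y :=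
  @Quiver.Hom.toPath _ edgeQuiver _ _ p

/-- Extension of a graph morphism from the generating graph to a category `C` to a functor. -/
def freeLift {C : Type u₃} [Category.{v₃} C] (obj : TensorObj A B → C)
    (map : ∀ {X Y : TensorObj A B}, Edge X Y → (obj X ⟶ obj Y)) : TensorObj A B ⥤ C where
  obj := obj
  map {X Y} p := @Quiver.Path.rec _ edgeQuiver X (fun Y _ => obj X ⟶ obj Y) (𝟙 (obj X))
    (fun _ e f => f ≫ map e) Y p
  map_id _ := rfl
  map_comp {X Y Z} p q := by
    change @Quiver.Path _ edgeQuiver Y Z at q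
    induction q with
    | nil => exact (Category.comp_id _).symm
    | cons q e ih => exact (congrArg (fun f => f ≫ map e) ih).trans (Category.assoc _ _ _)

lemma freeLift_gen {C : Type u₃} [Category.{v₃} C] (obj : TensorObj A B → C)
    (map : ∀ {X Y : TensorObj A B}, Edge X Y → (obj X ⟶ obj Y)) {X Y : TensorObj A B}
    (p : Edge X Y) : (freeLift obj map).map (gen p) = map p := Category.id_comp _

lemma free_induction {X : TensorObj A B} (P : ∀ {Y : TensorObj A B}, (X ⟶ Y) → Prop)
    (id : P (𝟙 X)) (comp : ∀ {Y Z : TensorObj A B} (p : X ⟶ Y) (e : Edge Y Z), P p → P (p ≫ gen e))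
    {Y : TensorObj A B} (p : X ⟶ Y) : P p := by
  change @Quiver.Path _ edgeQuiver X Y at p
  induction p with
  | nil => exact id
  | cons p e ih => exact comp p e ih

/-- The endofunctor `X ⊗ -` of the free category, applying `X ⊗ -` to each edge of a path. -/
def freeWhiskerLeft (X : TensorObj A B) : TensorObj A B ⥤ TensorObj A B :=
  freeLift (fun Y => TensorObj.tensor X Y) fun p => gen (Edge.whiskerLeft X p)

/-- The endofunctor `- ⊗ X` of the free category, applying `- ⊗ X` to each edge of a path. -/
def freeWhiskerRight (X : TensorObj A B) : TensorObj A B ⥤ TensorObj A B :=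
  freeLift (fun Y => TensorObj.tensor Y X) fun p => gen (Edge.whiskerRight p X)

/-- The arrow `p ⊗ q` of the free category for edges `p` and `q`: `p ⊗ Y` followed by `X' ⊗ q`. -/
def genTensor {X X' Y Y' : TensorObj A B} (p : Edge X X') (q : Edge Y Y') :
    TensorObj.tensor X Y ⟶ TensorObj.tensor X' Y' :=
  gen (p.whiskerRight Y) ≫ gen (q.whiskerLeft X')

variable [SymmetricCategory A] [SymmetricCategory B]

open TensorObj Edge in
/-- The relations defining `A ⊗ B`, closed under `X ⊗ -` and `- ⊗ X`. In order: interchange; the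
canonical edges are isomorphisms; coherence of the canonical edges; their naturality; functoriality
of `a ⊗ -` and of `- ⊗ b`; compatibility of `f ⊗ b` with `a ⊗ g`; naturality of `α`, `β`, `γ` and
`δ`; `(β, δ)` is a symmetric monoidal structure on `a ⊗ -`; `(α, γ)` is one on `- ⊗ b`; the
compatibilities between the two structures. Since `ac` goes from `X ⊗ (Y ⊗ Z)` to `(X ⊗ Y) ⊗ Z`, it
corresponds to the inverse of Mathlib's associator. -/
inductive Rel : HomRel (TensorObj A B)
  | exchange {X Y Z W : TensorObj A B} (t : Edge X Y) (s : Edge Z W) :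
      Rel (gen (s.whiskerLeft X) ≫ gen (t.whiskerRight W))
        (gen (t.whiskerRight Z) ≫ gen (s.whiskerLeft Y))
  | ac_acInv (X Y Z : TensorObj A B) : Rel (gen (ac X Y Z) ≫ gen (acInv X Y Z)) (𝟙 _)
  | acInv_ac (X Y Z : TensorObj A B) : Rel (gen (acInv X Y Z) ≫ gen (ac X Y Z)) (𝟙 _)
  | l_lInv (X : TensorObj A B) : Rel (gen (l X) ≫ gen (lInv X)) (𝟙 _)
  | lInv_l (X : TensorObj A B) : Rel (gen (lInv X) ≫ gen (l X)) (𝟙 _)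
  | r_rInv (X : TensorObj A B) : Rel (gen (r X) ≫ gen (rInv X)) (𝟙 _)
  | rInv_r (X : TensorObj A B) : Rel (gen (rInv X) ≫ gen (r X)) (𝟙 _)
  | s_s (X Y : TensorObj A B) : Rel (gen (s X Y) ≫ gen (s Y X)) (𝟙 _)
  | pentagon (X Y Z T : TensorObj A B) :
      Rel (gen (ac X Y (tensor Z T)) ≫ gen (ac (tensor X Y) Z T))
        (gen ((ac Y Z T).whiskerLeft X) ≫ gen (ac X (tensor Y Z) T) ≫
          gen ((ac X Y Z).whiskerRight T))
  | triangle (X Y : TensorObj A B) :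
      Rel (gen (ac X unit Y) ≫ gen ((r X).whiskerRight Y)) (gen ((l Y).whiskerLeft X))
  | s_l (X : TensorObj A B) : Rel (gen (s X unit) ≫ gen (l X)) (gen (r X))
  | hexagon (X Y Z : TensorObj A B) :
      Rel (gen (ac X Y Z) ≫ gen (s (tensor X Y) Z) ≫ gen (ac Z X Y))
        (gen ((s Y Z).whiskerLeft X) ≫ gen (ac X Z Y) ≫ gen ((s X Z).whiskerRight Y))
  | ac_naturality_left {X X' : TensorObj A B} (p : Edge X X') (Y Z : TensorObj A B) :
      Rel (gen (p.whiskerRight (tensor Y Z)) ≫ gen (ac X' Y Z))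
        (gen (ac X Y Z) ≫ gen ((p.whiskerRight Y).whiskerRight Z))
  | ac_naturality_middle (X : TensorObj A B) {Y Y' : TensorObj A B} (p : Edge Y Y')
      (Z : TensorObj A B) :
      Rel (gen ((p.whiskerRight Z).whiskerLeft X) ≫ gen (ac X Y' Z))
        (gen (ac X Y Z) ≫ gen ((p.whiskerLeft X).whiskerRight Z))
  | ac_naturality_right (X Y : TensorObj A B) {Z Z' : TensorObj A B} (p : Edge Z Z') :
      Rel (gen ((p.whiskerLeft Y).whiskerLeft X) ≫ gen (ac X Y Z'))
        (gen (ac X Y Z) ≫ gen (p.whiskerLeft (tensor X Y)))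
  | l_naturality {X X' : TensorObj A B} (p : Edge X X') :
      Rel (gen (p.whiskerLeft unit) ≫ gen (l X')) (gen (l X) ≫ gen p)
  | r_naturality {X X' : TensorObj A B} (p : Edge X X') :
      Rel (gen (p.whiskerRight unit) ≫ gen (r X')) (gen (r X) ≫ gen p)
  | s_naturality_left {X X' : TensorObj A B} (p : Edge X X') (Y : TensorObj A B) :
      Rel (gen (p.whiskerRight Y) ≫ gen (s X' Y)) (gen (s X Y) ≫ gen (p.whiskerLeft Y))
  | s_naturality_right (X : TensorObj A B) {Y Y' : TensorObj A B} (p : Edge Y Y') :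
      Rel (gen (p.whiskerLeft X) ≫ gen (s X Y')) (gen (s X Y) ≫ gen (p.whiskerRight X))
  | right_comp (a : A) {b b' b'' : B} (f : b ⟶ b') (g : b' ⟶ b'') :
      Rel (gen (right a (f ≫ g))) (gen (right a f) ≫ gen (right a g))
  | left_comp {a a' a'' : A} (f : a ⟶ a') (g : a' ⟶ a'') (b : B) :
      Rel (gen (left (f ≫ g) b)) (gen (left f b) ≫ gen (left g b))
  | right_id (a : A) (b : B) : Rel (gen (right a (𝟙 b))) (𝟙 _)
  | left_id (a : A) (b : B) : Rel (gen (left (𝟙 a) b)) (𝟙 _)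
  | left_right {a a' : A} (f : a ⟶ a') {b b' : B} (g : b ⟶ b') :
      Rel (gen (left f b) ≫ gen (right a' g)) (gen (right a g) ≫ gen (left f b'))
  | alpha_naturality {b b' : B} (g : b ⟶ b') :
      Rel (gen (alpha b) ≫ gen (right (𝟙_ A) g)) (gen (alpha b'))
  | beta_naturality {a a' : A} (f : a ⟶ a') :
      Rel (gen (beta a) ≫ gen (left f (𝟙_ B))) (gen (beta a'))
  | gamma_naturality_left {a₁ a₂ : A} (f : a₁ ⟶ a₂) (a' : A) (b : B) :
      Rel (gen ((left f b).whiskerRight (pair a' b)) ≫ gen (gamma a₂ a' b))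
        (gen (gamma a₁ a' b) ≫ gen (left (f ▷ a') b))
  | gamma_naturality_middle (a : A) {a₁ a₂ : A} (f : a₁ ⟶ a₂) (b : B) :
      Rel (gen ((left f b).whiskerLeft (pair a b)) ≫ gen (gamma a a₂ b))
        (gen (gamma a a₁ b) ≫ gen (left (a ◁ f) b))
  | gamma_naturality_right (a a' : A) {b b' : B} (g : b ⟶ b') :
      Rel (genTensor (right a g) (right a' g) ≫ gen (gamma a a' b'))
        (gen (gamma a a' b) ≫ gen (right (a ⊗ a') g))
  | delta_naturality_left {a a' : A} (f : a ⟶ a') (b b' : B) :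
      Rel (genTensor (left f b) (left f b') ≫ gen (delta a' b b'))
        (gen (delta a b b') ≫ gen (left f (b ⊗ b')))
  | delta_naturality_middle (a : A) {b₁ b₂ : B} (g : b₁ ⟶ b₂) (b' : B) :
      Rel (gen ((right a g).whiskerRight (pair a b')) ≫ gen (delta a b₂ b'))
        (gen (delta a b₁ b') ≫ gen (right a (g ▷ b')))
  | delta_naturality_right (a : A) (b : B) {b₁ b₂ : B} (g : b₁ ⟶ b₂) :
      Rel (gen ((right a g).whiskerLeft (pair a b)) ≫ gen (delta a b b₂))
        (gen (delta a b b₁) ≫ gen (right a (b ◁ g)))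
  | delta_assoc (a : A) (b b' b'' : B) :
      Rel (gen (ac (pair a b) (pair a b') (pair a b'')) ≫
          gen ((delta a b b').whiskerRight (pair a b'')) ≫ gen (delta a (b ⊗ b') b''))
        (gen ((delta a b' b'').whiskerLeft (pair a b)) ≫ gen (delta a b (b' ⊗ b'')) ≫
          gen (right a (α_ b b' b'').inv))
  | delta_r (a : A) (b : B) :
      Rel (gen (r (pair a b)))
        (gen ((beta a).whiskerLeft (pair a b)) ≫ gen (delta a b (𝟙_ B)) ≫
          gen (right a (ρ_ b).hom))
  | delta_l (a : A) (b : B) :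
      Rel (gen (l (pair a b)))
        (gen ((beta a).whiskerRight (pair a b)) ≫ gen (delta a (𝟙_ B) b) ≫
          gen (right a (λ_ b).hom))
  | delta_s (a : A) (b b' : B) :
      Rel (gen (delta a b b') ≫ gen (right a (β_ b b').hom))
        (gen (s (pair a b) (pair a b')) ≫ gen (delta a b' b))
  | gamma_assoc (a a' a'' : A) (b : B) :
      Rel (gen (ac (pair a b) (pair a' b) (pair a'' b)) ≫
          gen ((gamma a a' b).whiskerRight (pair a'' b)) ≫ gen (gamma (a ⊗ a') a'' b))
        (gen ((gamma a' a'' b).whiskerLeft (pair a b)) ≫ gen (gamma a (a' ⊗ a'') b) ≫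
          gen (left (α_ a a' a'').inv b))
  | gamma_r (a : A) (b : B) :
      Rel (gen (r (pair a b)))
        (gen ((alpha b).whiskerLeft (pair a b)) ≫ gen (gamma a (𝟙_ A) b) ≫
          gen (left (ρ_ a).hom b))
  | gamma_l (a : A) (b : B) :
      Rel (gen (l (pair a b)))
        (gen ((alpha b).whiskerRight (pair a b)) ≫ gen (gamma (𝟙_ A) a b) ≫
          gen (left (λ_ a).hom b))
  | gamma_s (a a' : A) (b : B) :
      Rel (gen (gamma a a' b) ≫ gen (left (β_ a a').hom b))
        (gen (s (pair a b) (pair a' b)) ≫ gen (gamma a' a b))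
  | alpha_tensor (b b' : B) :
      Rel (genTensor (alpha b) (alpha b') ≫ gen (delta (𝟙_ A) b b'))
        (gen (l unit) ≫ gen (alpha (b ⊗ b')))
  | beta_tensor (a a' : A) :
      Rel (genTensor (beta a) (beta a') ≫ gen (gamma a a' (𝟙_ B)))
        (gen (l unit) ≫ gen (beta (a ⊗ a')))
  | beta_alpha : Rel (gen (beta (𝟙_ A))) (gen (alpha (𝟙_ B)))
  | delta_gamma (a a' : A) (b b' : B) :
      Rel (genTensor (delta a b b') (delta a' b b') ≫ gen (gamma a a' (b ⊗ b')))
        (gen (acInv (pair a b) (pair a b') (tensor (pair a' b) (pair a' b'))) ≫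
          gen ((ac (pair a b') (pair a' b) (pair a' b')).whiskerLeft (pair a b)) ≫
          gen (((s (pair a b') (pair a' b)).whiskerRight (pair a' b')).whiskerLeft (pair a b)) ≫
          gen ((acInv (pair a' b) (pair a b') (pair a' b')).whiskerLeft (pair a b)) ≫
          gen (ac (pair a b) (pair a' b) (tensor (pair a b') (pair a' b'))) ≫
          genTensor (gamma a a' b) (gamma a a' b') ≫ gen (delta (a ⊗ a') b b'))
  | whiskerLeft (X : TensorObj A B) {Y Z : TensorObj A B} {p q : Y ⟶ Z} (h : Rel p q) :
      Rel ((freeWhiskerLeft X).map p) ((freeWhiskerLeft X).map q)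
  | whiskerRight {Y Z : TensorObj A B} {p q : Y ⟶ Z} (h : Rel p q) (X : TensorObj A B) :
      Rel ((freeWhiskerRight X).map p) ((freeWhiskerRight X).map q)

variable (A B) in
/-- The tensor `A ⊗ B`: the quotient of the free category by the congruence generated by the
relations. -/
abbrev TensorCat := CategoryTheory.Quotient (Rel (A := A) (B := B))

end Tensor

section Structure

variable {A : Type u₁} [Category.{v₁} A] [MonoidalCategory A] [SymmetricCategory A]
  {B : Type u₂} [Category.{v₂} B] [MonoidalCategory B] [SymmetricCategory B]

namespace TensorCat

/-- An object of `A ⊗ B`. -/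
abbrev mk (X : TensorObj A B) : TensorCat A B := ⟨X⟩

/-- The arrow of `A ⊗ B` represented by a path. -/
abbrev cls {X Y : TensorObj A B} (p : X ⟶ Y) : mk X ⟶ mk Y :=
  (CategoryTheory.Quotient.functor Rel).map p

/-- The arrow of `A ⊗ B` represented by an edge. -/
def edge {X Y : TensorObj A B} (p : Edge X Y) : mk X ⟶ mk Y := cls (gen p)

lemma rel {X Y : TensorObj A B} {p q : X ⟶ Y} (h : Rel p q) :
    cls p = cls q := CategoryTheory.Quotient.sound _ h

lemma cls_comp {X Y Z : TensorObj A B} (p : X ⟶ Y)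
    (q : Y ⟶ Z) : cls (p ≫ q) = cls p ≫ cls q := rfl

lemma naturality_comp {E : Type u₃} [Category.{v₃} E] (F G : TensorCat A B ⥤ E)
    (τ : ∀ X : TensorObj A B, F.obj (mk X) ⟶ G.obj (mk X)) {X Y Z : TensorObj A B}
    (p : mk X ⟶ mk Y) (q : mk Y ⟶ mk Z) (hp : F.map p ≫ τ Y = τ X ≫ G.map p)
    (hq : F.map q ≫ τ Z = τ Y ≫ G.map q) : F.map (p ≫ q) ≫ τ Z = τ X ≫ G.map (p ≫ q) := by
  rw [F.map_comp, G.map_comp, Category.assoc, hq, reassoc_of% hp]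

lemma naturality_of_edge {E : Type u₃} [Category.{v₃} E] (F G : TensorCat A B ⥤ E)
    (τ : ∀ X : TensorObj A B, F.obj (mk X) ⟶ G.obj (mk X))
    (h : ∀ {X Y : TensorObj A B} (p : Edge X Y), F.map (edge p) ≫ τ Y = τ X ≫ G.map (edge p))
    {X Y : TensorCat A B} (f : X ⟶ Y) : F.map f ≫ τ Y.as = τ X.as ≫ G.map f := by
  obtain ⟨X⟩ := X
  obtain ⟨Y⟩ := Y
  obtain ⟨p, rfl⟩ := (CategoryTheory.Quotient.functor (Rel (A := A) (B := B))).map_surjective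
    (X := X) (Y := Y) f
  refine free_induction (fun {b} p => F.map (cls p) ≫ τ b = τ X ≫ G.map (cls p)) ?_ ?_ p
  · change F.map (𝟙 (mk X)) ≫ _ = _ ≫ G.map (𝟙 (mk X))
    simp
  · intro Y Z p q hp
    exact naturality_comp F G τ (cls p) (edge q) hp (h q)

/-- The arrow `X ⊗ f` of `A ⊗ B`. -/
def wl (X : TensorObj A B) {Y Z : TensorCat A B} (f : Y ⟶ Z) :
    mk (X.tensor Y.as) ⟶ mk (X.tensor Z.as) :=
  (CategoryTheory.Quotient.lift Rel (freeWhiskerLeft X ⋙ CategoryTheory.Quotient.functor Rel)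
    fun _ _ _ _ h => CategoryTheory.Quotient.sound _ (Rel.whiskerLeft X h)).map f

/-- The arrow `f ⊗ X` of `A ⊗ B`. -/
def wr {Y Z : TensorCat A B} (f : Y ⟶ Z) (X : TensorObj A B) :
    mk (Y.as.tensor X) ⟶ mk (Z.as.tensor X) :=
  (CategoryTheory.Quotient.lift Rel (freeWhiskerRight X ⋙ CategoryTheory.Quotient.functor Rel)
    fun _ _ _ _ h => CategoryTheory.Quotient.sound _ (Rel.whiskerRight h X)).map f

lemma wl_id (X : TensorObj A B) (Y : TensorCat A B) : wl X (𝟙 Y) = 𝟙 (mk (X.tensor Y.as)) :=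
  CategoryTheory.Functor.map_id _ Y

lemma wr_id (Y : TensorCat A B) (X : TensorObj A B) : wr (𝟙 Y) X = 𝟙 (mk (Y.as.tensor X)) :=
  CategoryTheory.Functor.map_id _ Y

lemma wl_comp (X : TensorObj A B) {Y Z W : TensorCat A B} (f : Y ⟶ Z) (g : Z ⟶ W) :
    wl X (f ≫ g) = wl X f ≫ wl X g := CategoryTheory.Functor.map_comp _ f g

lemma wr_comp {Y Z W : TensorCat A B} (f : Y ⟶ Z) (g : Z ⟶ W) (X : TensorObj A B) :
    wr (f ≫ g) X = wr f X ≫ wr g X := CategoryTheory.Functor.map_comp _ f g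

lemma wl_edge (X : TensorObj A B) {Y Z : TensorObj A B} (p : Edge Y Z) :
    wl X (edge p) = edge (p.whiskerLeft X) :=
  congrArg cls (freeLift_gen _ _ p)

lemma wr_edge {Y Z : TensorObj A B} (p : Edge Y Z) (X : TensorObj A B) :
    wr (edge p) X = edge (p.whiskerRight X) :=
  congrArg cls (freeLift_gen _ _ p)

/-- `X ⊗ -` as an endofunctor -/
abbrev wlFunctor (X : TensorObj A B) : TensorCat A B ⥤ TensorCat A B where
  obj Y := mk (X.tensor Y.as)
  map f := wl X f
  map_id := wl_id X
  map_comp := wl_comp X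

/-- `- ⊗ X` as an endofunctor -/
abbrev wrFunctor (X : TensorObj A B) : TensorCat A B ⥤ TensorCat A B where
  obj Y := mk (Y.as.tensor X)
  map f := wr f X
  map_id Y := wr_id Y X
  map_comp f g := wr_comp f g X

lemma exchange {X Y : TensorCat A B} {Z W : TensorCat A B} (f : X ⟶ Y) (g : Z ⟶ W) :
    wl X.as g ≫ wr f W.as = wr f Z.as ≫ wl Y.as g := by
  refine naturality_of_edge (wlFunctor X.as) (wlFunctor Y.as) (fun Z => wr f Z) ?_ g
  intro Z W s
  refine (naturality_of_edge (wrFunctor Z) (wrFunctor W) (fun X => wl X (edge s)) ?_ f).symm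
  intro X Y t
  simp only [wl_edge, wr_edge]
  exact (rel (Rel.exchange t s)).symm

/-- The associativity isomorphism of `A ⊗ B`, in Mathlib's direction. -/
def assocIso (X Y Z : TensorObj A B) : mk ((X.tensor Y).tensor Z) ≅ mk (X.tensor (Y.tensor Z)) where
  hom := edge (.acInv X Y Z)
  inv := edge (.ac X Y Z)
  hom_inv_id := rel (.acInv_ac X Y Z)
  inv_hom_id := rel (.ac_acInv X Y Z)

/-- The left unit isomorphism of `A ⊗ B`. -/
def lIso (X : TensorObj A B) : mk (TensorObj.unit.tensor X) ≅ mk X where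
  hom := edge (.l X)
  inv := edge (.lInv X)
  hom_inv_id := rel (.l_lInv X)
  inv_hom_id := rel (.lInv_l X)

/-- The right unit isomorphism of `A ⊗ B`. -/
def rIso (X : TensorObj A B) : mk (X.tensor TensorObj.unit) ≅ mk X where
  hom := edge (.r X)
  inv := edge (.rInv X)
  hom_inv_id := rel (.r_rInv X)
  inv_hom_id := rel (.rInv_r X)

/-- The symmetry of `A ⊗ B`. -/
def sIso (X Y : TensorObj A B) : mk (X.tensor Y) ≅ mk (Y.tensor X) where
  hom := edge (.s X Y)
  inv := edge (.s Y X)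
  hom_inv_id := rel (.s_s X Y)
  inv_hom_id := rel (.s_s Y X)

lemma assocIso_inv_naturality_left {X X' : TensorCat A B} (f : X ⟶ X') (Y Z : TensorObj A B) :
    wr f (Y.tensor Z) ≫ (assocIso X'.as Y Z).inv =
      (assocIso X.as Y Z).inv ≫ wr (wr f Y) Z := by
  refine naturality_of_edge (wrFunctor (Y.tensor Z)) (wrFunctor Y ⋙ wrFunctor Z)
    (fun X => (assocIso X Y Z).inv) ?_ f
  intro X X' p
  simp only [wr_edge, Functor.comp_map]
  exact rel (.ac_naturality_left p Y Z)

lemma assocIso_inv_naturality_middle (X : TensorObj A B) {Y Y' : TensorCat A B} (f : Y ⟶ Y')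
    (Z : TensorObj A B) :
    wl X (wr f Z) ≫ (assocIso X Y'.as Z).inv = (assocIso X Y.as Z).inv ≫ wr (wl X f) Z := by
  refine naturality_of_edge (wrFunctor Z ⋙ wlFunctor X) (wlFunctor X ⋙ wrFunctor Z)
    (fun Y => (assocIso X Y Z).inv) ?_ f
  intro Y Y' p
  simp only [wr_edge, wl_edge, Functor.comp_map]
  exact rel (.ac_naturality_middle X p Z)

lemma assocIso_inv_naturality_right (X Y : TensorObj A B) {Z Z' : TensorCat A B} (f : Z ⟶ Z') :
    wl X (wl Y f) ≫ (assocIso X Y Z'.as).inv =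
      (assocIso X Y Z.as).inv ≫ wl (X.tensor Y) f := by
  refine naturality_of_edge (wlFunctor Y ⋙ wlFunctor X) (wlFunctor (X.tensor Y))
    (fun Z => (assocIso X Y Z).inv) ?_ f
  intro Z Z' p
  simp only [wl_edge, Functor.comp_map]
  exact rel (.ac_naturality_right X Y p)

lemma lIso_naturality {X X' : TensorCat A B} (f : X ⟶ X') :
    wl .unit f ≫ (lIso X'.as).hom = (lIso X.as).hom ≫ f := by
  refine naturality_of_edge (wlFunctor .unit) (𝟭 _) (fun X => (lIso X).hom) ?_ f
  intro X X' p
  simp only [wl_edge]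
  exact rel (.l_naturality p)

lemma rIso_naturality {X X' : TensorCat A B} (f : X ⟶ X') :
    wr f .unit ≫ (rIso X'.as).hom = (rIso X.as).hom ≫ f := by
  refine naturality_of_edge (wrFunctor .unit) (𝟭 _) (fun X => (rIso X).hom) ?_ f
  intro X X' p
  simp only [wr_edge]
  exact rel (.r_naturality p)

lemma sIso_naturality_left {X X' : TensorCat A B} (f : X ⟶ X') (Y : TensorObj A B) :
    wr f Y ≫ (sIso X'.as Y).hom = (sIso X.as Y).hom ≫ wl Y f := by
  refine naturality_of_edge (wrFunctor Y) (wlFunctor Y) (fun X => (sIso X Y).hom) ?_ f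
  intro X X' p
  simp only [wr_edge, wl_edge]
  exact rel (.s_naturality_left p Y)

lemma sIso_naturality_right (X : TensorObj A B) {Y Y' : TensorCat A B} (f : Y ⟶ Y') :
    wl X f ≫ (sIso X Y'.as).hom = (sIso X Y.as).hom ≫ wr f X := by
  refine naturality_of_edge (wlFunctor X) (wrFunctor X) (fun Y => (sIso X Y).hom) ?_ f
  intro Y Y' p
  simp only [wr_edge, wl_edge]
  exact rel (.s_naturality_right X p)

instance : MonoidalCategoryStruct (TensorCat A B) where
  tensorObj X Y := mk (X.as.tensor Y.as)
  whiskerLeft X _ _ f := wl X.as f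
  whiskerRight f X := wr f X.as
  tensorHom {_ Y₁ X₂ _} f g := wr f X₂.as ≫ wl Y₁.as g
  tensorUnit := mk .unit
  associator X Y Z := assocIso X.as Y.as Z.as
  leftUnitor X := lIso X.as
  rightUnitor X := rIso X.as

lemma whiskerLeft_edge (X : TensorObj A B) {Y Z : TensorObj A B} (p : Edge Y Z) :
    mk X ◁ edge p = edge (p.whiskerLeft X) := wl_edge X p

lemma whiskerRight_edge {Y Z : TensorObj A B} (p : Edge Y Z) (X : TensorObj A B) :
    edge p ▷ mk X = edge (p.whiskerRight X) := wr_edge p X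

lemma pentagon_ac (X Y Z T : TensorObj A B) :
    (assocIso X Y (Z.tensor T)).inv ≫ (assocIso (X.tensor Y) Z T).inv =
      wl X (assocIso Y Z T).inv ≫ (assocIso X (Y.tensor Z) T).inv ≫
        wr (assocIso X Y Z).inv T := by
  change _ = wl X (edge _) ≫ _ ≫ wr (edge _) T
  rw [wl_edge, wr_edge]
  exact rel (.pentagon X Y Z T)

lemma triangle_ac (X Y : TensorObj A B) :
    (assocIso X .unit Y).inv ≫ wr (rIso X).hom Y = wl X (lIso Y).hom := by
  change _ ≫ wr (edge _) Y = wl X (edge _)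
  rw [wl_edge, wr_edge]
  exact rel (.triangle X Y)

lemma hexagon_ac (X Y Z : TensorObj A B) :
    (assocIso X Y Z).inv ≫ (sIso (X.tensor Y) Z).hom ≫ (assocIso Z X Y).inv =
      wl X (sIso Y Z).hom ≫ (assocIso X Z Y).inv ≫ wr (sIso X Z).hom Y := by
  change _ = wl X (edge _) ≫ _ ≫ wr (edge _) Y
  rw [wl_edge, wr_edge]
  exact rel (.hexagon X Y Z)

instance : MonoidalCategory (TensorCat A B) where
  tensorHom_def _ _ := rfl
  id_tensorHom_id X Y := by
    change wr (𝟙 X) Y.as ≫ wl X.as (𝟙 Y) = 𝟙 (mk (X.as.tensor Y.as))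
    rw [wr_id, wl_id, Category.comp_id]
  tensorHom_comp_tensorHom {X₁ Y₁ Z₁ X₂ Y₂ Z₂} f₁ f₂ g₁ g₂ := by
    change (wr f₁ X₂.as ≫ wl Y₁.as f₂) ≫ wr g₁ Y₂.as ≫ wl Z₁.as g₂ =
      wr (f₁ ≫ g₁) X₂.as ≫ wl Z₁.as (f₂ ≫ g₂)
    have h := exchange g₁ f₂
    rw [wl_comp, wr_comp, Category.assoc, Category.assoc, reassoc_of% h]
  whiskerLeft_id X Y := wl_id X.as Y
  id_whiskerRight X Y := wr_id X Y.as
  associator_naturality {X₁ X₂ X₃ Y₁ Y₂ Y₃} f₁ f₂ f₃ := by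
    rw [← Iso.eq_comp_inv, Category.assoc, ← Iso.inv_comp_eq]
    change (assocIso X₁.as X₂.as X₃.as).inv ≫ wr (wr f₁ X₂.as ≫
      wl Y₁.as f₂) X₃.as ≫ wl (Y₁.as.tensor Y₂.as) f₃ =
      (wr f₁ (X₂.as.tensor X₃.as) ≫ wl Y₁.as (wr f₂ X₃.as ≫
        wl Y₂.as f₃)) ≫ (assocIso Y₁.as Y₂.as Y₃.as).inv
    have h₁ := assocIso_inv_naturality_left f₁ X₂.as X₃.as
    have h₂ := assocIso_inv_naturality_middle Y₁.as f₂ X₃.as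
    have h₃ := assocIso_inv_naturality_right Y₁.as Y₂.as f₃
    rw [wl_comp, wr_comp, Category.assoc, Category.assoc, Category.assoc, h₃,
      reassoc_of% h₂, reassoc_of% h₁]
  leftUnitor_naturality f := lIso_naturality f
  rightUnitor_naturality f := rIso_naturality f
  pentagon W X Y Z := by
    have h := pentagon_ac W.as X.as Y.as Z.as
    change wr (assocIso W.as X.as Y.as).hom Z.as ≫ (assocIso W.as (X.as.tensor Y.as) Z.as).hom ≫
      wl W.as (assocIso X.as Y.as Z.as).hom = (assocIso (W.as.tensor X.as) Y.as Z.as).hom ≫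
        (assocIso W.as X.as (Y.as.tensor Z.as)).hom
    rw [← cancel_mono ((assocIso W.as X.as (Y.as.tensor Z.as)).inv ≫
      (assocIso (W.as.tensor X.as) Y.as Z.as).inv)]
    conv_lhs => rw [h]
    simp only [Category.assoc, Iso.hom_inv_id_assoc, Iso.hom_inv_id]
    rw [← reassoc_of% (wl_comp W.as), Iso.hom_inv_id, wl_id, Category.id_comp,
      Iso.hom_inv_id_assoc, ← wr_comp, Iso.hom_inv_id, wr_id]
  triangle X Y := by
    have h := triangle_ac X.as Y.as
    change (assocIso X.as .unit Y.as).hom ≫ wl X.as (lIso Y.as).hom = wr (rIso X.as).hom Y.as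
    rw [← h, Iso.hom_inv_id_assoc]

instance : SymmetricCategory (TensorCat A B) where
  braiding X Y := sIso X.as Y.as
  braiding_naturality_right X _ _ f := sIso_naturality_right X.as f
  braiding_naturality_left f Z := sIso_naturality_left f Z.as
  hexagon_forward X Y Z := by
    have h := hexagon_ac Y.as Z.as X.as
    change (assocIso X.as Y.as Z.as).hom ≫ (sIso X.as (Y.as.tensor Z.as)).hom ≫
      (assocIso Y.as Z.as X.as).hom = wr (sIso X.as Y.as).hom Z.as ≫
        (assocIso Y.as X.as Z.as).hom ≫ wl Y.as (sIso X.as Z.as).hom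
    rw [← cancel_mono ((assocIso Y.as Z.as X.as).inv ≫ (sIso (Y.as.tensor Z.as) X.as).hom ≫
      (assocIso X.as Y.as Z.as).inv)]
    conv_rhs => rw [h]
    have hs : ∀ X Y : TensorObj A B, (sIso X Y).hom ≫ (sIso Y X).hom = 𝟙 _ := fun X Y =>
      (sIso X Y).hom_inv_id
    simp only [Category.assoc, Iso.hom_inv_id_assoc]
    rw [reassoc_of% hs, Iso.hom_inv_id, ← reassoc_of% (wl_comp Y.as), hs, wl_id, Category.id_comp,
      Iso.hom_inv_id_assoc, ← wr_comp, hs, wr_id]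
  hexagon_reverse X Y Z := hexagon_ac X.as Y.as Z.as
  symmetry X Y := (sIso X.as Y.as).hom_inv_id

end TensorCat
end Structure

section Eta

open Functor.LaxMonoidal

variable {A : Type u₁} [Category.{v₁} A] [MonoidalCategory A] [SymmetricCategory A]
  {B : Type u₂} [Category.{v₂} B] [MonoidalCategory B] [SymmetricCategory B]

namespace TensorCat

lemma cls_genTensor {X X' Y Y' : TensorObj A B} (p : Edge X X') (q : Edge Y Y') :
    cls (genTensor p q) = edge p ⊗ₘ edge q := by
  change edge (p.whiskerRight Y) ≫ edge (q.whiskerLeft X') = wr (edge p) Y ≫ wl X' (edge q)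
  rw [wr_edge, wl_edge]

/-- The symmetric monoidal functor `η(a) : B ⥤ A ⊗ B`, `b ↦ a ⊗ b`, with structure arrows `β_a`
and `δ_{a,b,b'}`. -/
def etaObj (a : A) : LaxBraidedFunctor B (TensorCat A B) where
  toFunctor :=
    { obj := fun b => mk (.pair a b)
      map := fun g => edge (.right a g)
      map_id := fun b => rel (.right_id a b)
      map_comp := fun f g => rel (.right_comp a f g) }
  laxBraided :=
    { ε := edge (.beta a)
      μ := fun b b' => edge (.delta a b b')
      μ_natural_left := fun g b' => by
        change wr (edge (.right a g)) (.pair a b') ≫ edge _ = edge _ ≫ edge _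
        rw [wr_edge]
        exact rel (.delta_naturality_middle a g b')
      μ_natural_right := fun b g => by
        change wl (.pair a b) (edge (.right a g)) ≫ edge _ = edge _ ≫ edge _
        rw [wl_edge]
        exact rel (.delta_naturality_right a b g)
      associativity := fun b b' b'' => by
        change wr (edge (.delta a b b')) (.pair a b'') ≫ edge (.delta a (b ⊗ b') b'') ≫
          edge (.right a (α_ b b' b'').hom) = (assocIso _ _ _).hom ≫
            wl (.pair a b) (edge (.delta a b' b'')) ≫ edge (.delta a b (b' ⊗ b''))
        have h : (assocIso _ _ _).inv ≫ edge _ ≫ edge _ = edge _ ≫ edge _ ≫ edge _ :=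
          rel (Rel.delta_assoc a b b' b'')
        have h2 : edge (.right a (α_ b b' b'').inv) ≫ edge (.right a (α_ b b' b'').hom) =
            𝟙 (mk (TensorObj.pair a (b ⊗ b' ⊗ b''))) := by
          refine (rel (.right_comp a _ _)).symm.trans ?_
          rw [Iso.inv_hom_id]
          exact rel (.right_id a _)
        rw [Iso.inv_comp_eq] at h
        rw [wr_edge, wl_edge, reassoc_of% h, h2, Category.comp_id]
      left_unitality := fun b => by
        change edge _ = wr (edge _) (.pair a b) ≫ edge _ ≫ edge _
        rw [wr_edge]
        exact rel (.delta_l a b)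
      right_unitality := fun b => by
        change edge _ = wl (.pair a b) (edge _) ≫ edge _ ≫ edge _
        rw [wl_edge]
        exact rel (.delta_r a b)
      braided := fun b b' => rel (.delta_s a b b') }

lemma edge_delta_gamma (a a' : A) (b b' : B) :
    (edge (.delta a b b') ⊗ₘ edge (.delta a' b b')) ≫ edge (.gamma a a' (b ⊗ b')) =
      tensorμ (mk (.pair a b)) (mk (.pair a b')) (mk (.pair a' b)) (mk (.pair a' b')) ≫
        (edge (.gamma a a' b) ⊗ₘ edge (.gamma a a' b')) ≫ edge (.delta (a ⊗ a') b b') := by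
  rw [← cls_genTensor, ← cls_genTensor]
  refine (rel (.delta_gamma a a' b b')).trans ?_
  have h : tensorμ (mk (.pair a b)) (mk (.pair a b')) (mk (.pair a' b)) (mk (.pair a' b')) =
      (assocIso (.pair a b) (.pair a b') (.tensor (.pair a' b) (.pair a' b'))).hom ≫
        edge (Edge.whiskerLeft (.pair a b) (.ac (.pair a b') (.pair a' b) (.pair a' b'))) ≫
        edge (Edge.whiskerLeft (.pair a b)
          (.whiskerRight (.s (.pair a b') (.pair a' b)) (.pair a' b'))) ≫
        edge (Edge.whiskerLeft (.pair a b) (.acInv (.pair a' b) (.pair a b') (.pair a' b'))) ≫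
        (assocIso (.pair a b) (.pair a' b) (.tensor (.pair a b') (.pair a' b'))).inv := by
    rw [← wl_edge, ← wl_edge, ← wl_edge, ← wr_edge]
    rfl
  rw [h]
  simp only [Category.assoc]
  rfl

end TensorCat

open TensorCat

variable (A B) in
/-- The symmetric monoidal functor `η : A ⥤ [B, A ⊗ B]`, `a ↦ η(a)`; the component of `η(f)` at `b`
is `f ⊗ b`, and those of the structure arrows of `η` at `b` are `α_b` and `γ_{a,a',b}`. -/
def eta : LaxBraidedFunctor A (LaxBraidedFunctor B (TensorCat A B)) where
  toFunctor :=
    { obj := fun a => etaObj a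
      map := fun {a a'} f => mkHom (F := etaObj a) (G := etaObj a') (fun b => edge (.left f b))
        (fun g => (rel (.left_right f g)).symm)
        (rel (.beta_naturality f))
        (fun b b' => by
          refine Eq.trans ?_ (congrArg (fun t => t ≫ _) (cls_genTensor (.left f b) (.left f b')))
          exact (rel (.delta_naturality_left f b b')).symm)
      map_id := fun a => hom_ext_app fun b => rel (.left_id a b)
      map_comp := fun f g => hom_ext_app fun b => rel (.left_comp f g b) }
  laxBraided :=
    { ε := mkHom (F := homUnit) (G := etaObj (𝟙_ A)) (fun b => edge (.alpha b))
        (fun g => by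
          refine (Category.id_comp _).trans ?_
          exact (rel (.alpha_naturality g)).symm)
        (by
          refine (Category.id_comp _).trans ?_
          exact (rel .beta_alpha).symm)
        (fun b b' => by
          refine Eq.trans ?_ (congrArg (fun t => t ≫ _) (cls_genTensor (.alpha b) (.alpha b')))
          exact (rel (.alpha_tensor b b')).symm)
      μ := fun a a' => mkHom (F := box (etaObj a) (etaObj a')) (G := etaObj (a ⊗ a'))
        (fun b => edge (.gamma a a' b))
        (fun g => by
          refine (congrArg (fun t => t ≫ _) (cls_genTensor (.right a g) (.right a' g)).symm).trans ?_
          exact rel (.gamma_naturality_right a a' g))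
        (by
          change ((λ_ (𝟙_ (TensorCat A B))).inv ≫ (edge (.beta a) ⊗ₘ edge (.beta a'))) ≫
            edge (.gamma a a' (𝟙_ B)) = edge (.beta (a ⊗ a'))
          rw [Category.assoc, Iso.inv_comp_eq, ← cls_genTensor]
          exact rel (.beta_tensor a a'))
        (fun b b' => by
          change (tensorμ _ _ _ _ ≫ (edge (.delta a b b') ⊗ₘ edge (.delta a' b b'))) ≫
            edge (.gamma a a' (b ⊗ b')) = (edge (.gamma a a' b) ⊗ₘ edge (.gamma a a' b')) ≫
              edge (.delta (a ⊗ a') b b')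
          rw [Category.assoc, edge_delta_gamma, ← Category.assoc, tensorμ_tensorμ,
            Category.id_comp])
      μ_natural_left := fun {a₁ a₂} f a' => hom_ext_app fun b => by
        change wr (edge (.left f b)) (.pair a' b) ≫ edge _ = edge _ ≫ edge _
        rw [wr_edge]
        exact rel (.gamma_naturality_left f a' b)
      μ_natural_right := fun {a₁ a₂} a f => hom_ext_app fun b => by
        change wl (.pair a b) (edge (.left f b)) ≫ edge _ = edge _ ≫ edge _
        rw [wl_edge]
        exact rel (.gamma_naturality_middle a f b)
      associativity := fun a a' a'' => hom_ext_app fun b => by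
        change wr (edge (.gamma a a' b)) (.pair a'' b) ≫ edge (.gamma (a ⊗ a') a'' b) ≫
          edge (.left (α_ a a' a'').hom b) = (assocIso _ _ _).hom ≫
            wl (.pair a b) (edge (.gamma a' a'' b)) ≫ edge (.gamma a (a' ⊗ a'') b)
        have h : (assocIso _ _ _).inv ≫ edge _ ≫ edge _ = edge _ ≫ edge _ ≫ edge _ :=
          rel (Rel.gamma_assoc a a' a'' b)
        have h2 : edge (.left (α_ a a' a'').inv b) ≫ edge (.left (α_ a a' a'').hom b) =
            𝟙 (mk (TensorObj.pair (a ⊗ a' ⊗ a'') b)) := by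
          refine (rel (.left_comp _ _ b)).symm.trans ?_
          rw [Iso.inv_hom_id]
          exact rel (.left_id _ b)
        rw [Iso.inv_comp_eq] at h
        rw [wr_edge, wl_edge, reassoc_of% h, h2, Category.comp_id]
      left_unitality := fun a => hom_ext_app fun b => by
        change edge _ = wr (edge _) (.pair a b) ≫ edge _ ≫ edge _
        rw [wr_edge]
        exact rel (.gamma_l a b)
      right_unitality := fun a => hom_ext_app fun b => by
        change edge _ = wl (.pair a b) (edge _) ≫ edge _ ≫ edge _
        rw [wl_edge]
        exact rel (.gamma_r a b)
      braided := fun a a' => hom_ext_app fun b => rel (.gamma_s a a' b) }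

end Eta

section En

open Functor.LaxMonoidal

variable {A : Type u₁} [Category.{v₁} A] [MonoidalCategory A] [SymmetricCategory A]
  {B : Type u₂} [Category.{v₂} B] [MonoidalCategory B] [SymmetricCategory B]
  {C : Type u₃} [Category.{v₃} C] [MonoidalCategory C] [SymmetricCategory C]

namespace En

/-- The object `En(F)(X)` of `C`. -/
def obj (F : LaxBraidedFunctor A (LaxBraidedFunctor B C)) : TensorObj A B → C
  | .unit => 𝟙_ C
  | .pair a b => (F.obj a).obj b
  | .tensor X Y => obj F X ⊗ obj F Y

/-- The value of `En(F)` on the edges generating `A ⊗ B`. -/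
def edgeMap (F : LaxBraidedFunctor A (LaxBraidedFunctor B C)) :
    ∀ {X Y : TensorObj A B}, Edge X Y → (obj F X ⟶ obj F Y)
  | _, _, .ac X Y Z => (α_ (obj F X) (obj F Y) (obj F Z)).inv
  | _, _, .acInv X Y Z => (α_ (obj F X) (obj F Y) (obj F Z)).hom
  | _, _, .l X => (λ_ (obj F X)).hom
  | _, _, .lInv X => (λ_ (obj F X)).inv
  | _, _, .r X => (ρ_ (obj F X)).hom
  | _, _, .rInv X => (ρ_ (obj F X)).inv
  | _, _, .s X Y => (β_ (obj F X) (obj F Y)).hom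
  | _, _, .alpha b => (nat (ε F.toFunctor)).app b
  | _, _, .beta a => ε (F.obj a).toFunctor
  | _, _, .gamma a a' b => (nat (μ F.toFunctor a a')).app b
  | _, _, .delta a b b' => μ (F.obj a).toFunctor b b'
  | _, _, .right a g => (F.obj a).map g
  | _, _, .left f b => (nat (F.map f)).app b
  | _, _, .whiskerLeft X p => obj F X ◁ edgeMap F p
  | _, _, .whiskerRight p X => edgeMap F p ▷ obj F X

/-- The extension of `edgeMap` to the free category. -/
def free (F : LaxBraidedFunctor A (LaxBraidedFunctor B C)) : TensorObj A B ⥤ C :=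
  freeLift (obj F) (edgeMap F)

lemma free_gen (F : LaxBraidedFunctor A (LaxBraidedFunctor B C)) {X Y : TensorObj A B}
    (p : Edge X Y) : (free F).map (gen p) = edgeMap F p := freeLift_gen _ _ p

lemma free_comp (F : LaxBraidedFunctor A (LaxBraidedFunctor B C)) {X Y Z : TensorObj A B}
    (p : X ⟶ Y) (q : Y ⟶ Z) :
    (free F).map (p ≫ q) = ((free F).map p : obj F X ⟶ obj F Y) ≫ (free F).map q :=
  (free F).map_comp p q

lemma free_id (F : LaxBraidedFunctor A (LaxBraidedFunctor B C)) (X : TensorObj A B) :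
    (free F).map (𝟙 X) = 𝟙 (obj F X) := rfl

lemma free_genTensor (F : LaxBraidedFunctor A (LaxBraidedFunctor B C)) {X X' Y Y' : TensorObj A B}
    (p : Edge X X') (q : Edge Y Y') :
    (free F).map (genTensor p q) = edgeMap F p ⊗ₘ edgeMap F q := by
  rw [genTensor, free_comp, free_gen, free_gen, MonoidalCategory.tensorHom_def]
  rfl

lemma free_whiskerLeft (F : LaxBraidedFunctor A (LaxBraidedFunctor B C)) (X : TensorObj A B)
    {Y Z : TensorObj A B} (p : Y ⟶ Z) :
    (free F).map ((freeWhiskerLeft X).map p) = obj F X ◁ (free F).map p := by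
  refine free_induction (fun {Z} p =>
    (free F).map ((freeWhiskerLeft X).map p) = obj F X ◁ (free F).map p) ?_ ?_ p
  · exact (whiskerLeft_id _ _).symm
  · intro Z W p e hp
    refine (free_comp F ((freeWhiskerLeft X).map p : X.tensor Y ⟶ X.tensor Z)
      (gen (e.whiskerLeft X))).trans ?_
    rw [free_comp, free_gen]
    refine Eq.trans ?_ (whiskerLeft_comp _ _ _).symm
    exact congr (congrArg (fun s t => s ≫ t) hp) (free_gen F (e.whiskerLeft X))

lemma free_whiskerRight (F : LaxBraidedFunctor A (LaxBraidedFunctor B C)) {Y Z : TensorObj A B}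
    (p : Y ⟶ Z) (X : TensorObj A B) :
    (free F).map ((freeWhiskerRight X).map p) = (free F).map p ▷ obj F X := by
  refine free_induction (fun {Z} p =>
    (free F).map ((freeWhiskerRight X).map p) = (free F).map p ▷ obj F X) ?_ ?_ p
  · exact (id_whiskerRight _ _).symm
  · intro Z W p e hp
    refine (free_comp F ((freeWhiskerRight X).map p : Y.tensor X ⟶ Z.tensor X)
      (gen (e.whiskerRight X))).trans ?_
    rw [free_comp, free_gen]
    refine Eq.trans ?_ (comp_whiskerRight _ _ _).symm
    exact congr (congrArg (fun s t => s ≫ t) hp) (free_gen F (e.whiskerRight X))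

lemma app_comp {G H K : LaxBraidedFunctor B C} (σ : G ⟶ H) (τ : H ⟶ K) (b : B) :
    (nat (σ ≫ τ)).app b = (nat σ).app b ≫ (nat τ).app b := rfl

lemma congr_app {G H : LaxBraidedFunctor B C} {σ τ : G ⟶ H} (h : σ = τ) (b : B) :
    (nat σ).app b = (nat τ).app b := by rw [h]

lemma free_rel (F : LaxBraidedFunctor A (LaxBraidedFunctor B C)) {X Y : TensorObj A B}
    {p q : X ⟶ Y} (h : Rel p q) : (free F).map p = (free F).map q := by
  induction h with
  | whiskerLeft X h ih => rw [free_whiskerLeft, free_whiskerLeft, ih]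
  | whiskerRight h X ih => rw [free_whiskerRight, free_whiskerRight, ih]
  | exchange t s =>
    rw [free_comp, free_comp, free_gen, free_gen, free_gen, free_gen]
    exact whisker_exchange _ _
  | ac_acInv X Y Z =>
    rw [free_comp, free_gen, free_gen]
    exact Iso.inv_hom_id _
  | acInv_ac X Y Z =>
    rw [free_comp, free_gen, free_gen]
    exact Iso.hom_inv_id _
  | l_lInv X =>
    rw [free_comp, free_gen, free_gen]
    exact Iso.hom_inv_id _
  | lInv_l X =>
    rw [free_comp, free_gen, free_gen]
    exact Iso.inv_hom_id _
  | r_rInv X =>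
    rw [free_comp, free_gen, free_gen]
    exact Iso.hom_inv_id _
  | rInv_r X =>
    rw [free_comp, free_gen, free_gen]
    exact Iso.inv_hom_id _
  | s_s X Y =>
    rw [free_comp, free_gen, free_gen]
    exact SymmetricCategory.symmetry _ _
  | pentagon X Y Z T =>
    simp only [free_comp, free_gen]
    exact (MonoidalCategory.pentagon_inv).symm
  | triangle X Y =>
    simp only [free_comp, free_gen]
    exact triangle_assoc_comp_right (obj F X) (obj F Y)
  | s_l X =>
    simp only [free_comp, free_gen]
    exact braiding_leftUnitor (obj F X)
  | hexagon X Y Z =>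
    simp only [free_comp, free_gen]
    exact BraidedCategory.hexagon_reverse (obj F X) (obj F Y) (obj F Z)
  | ac_naturality_left p Y Z =>
    simp only [free_comp, free_gen]
    exact associator_inv_naturality_left _ _ _
  | ac_naturality_middle X p Z =>
    simp only [free_comp, free_gen]
    exact associator_inv_naturality_middle _ _ _
  | ac_naturality_right X Y p =>
    simp only [free_comp, free_gen]
    exact associator_inv_naturality_right _ _ _
  | l_naturality p =>
    simp only [free_comp, free_gen]
    exact leftUnitor_naturality _
  | r_naturality p =>
    simp only [free_comp, free_gen]
    exact rightUnitor_naturality _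
  | s_naturality_left p Y =>
    simp only [free_comp, free_gen]
    exact BraidedCategory.braiding_naturality_left _ _
  | s_naturality_right X p =>
    simp only [free_comp, free_gen]
    exact BraidedCategory.braiding_naturality_right _ _
  | right_comp a f g =>
    simp only [free_comp, free_gen]
    exact (F.obj a).map_comp f g
  | left_comp f g b =>
    simp only [free_comp, free_gen]
    exact congr_app (F.map_comp f g) b
  | right_id a b =>
    simp only [free_gen]
    exact (F.obj a).map_id b
  | left_id a b =>
    simp only [free_gen]
    exact congr_app (F.map_id a) b
  | left_right f g =>
    simp only [free_comp, free_gen]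
    exact ((nat (F.map f)).naturality g).symm
  | alpha_naturality g =>
    simp only [free_comp, free_gen]
    exact ((nat (ε F.toFunctor)).naturality g).symm.trans (Category.id_comp _)
  | beta_naturality f =>
    simp only [free_comp, free_gen]
    exact hom_unit (F.map f)
  | gamma_naturality_left f a' b =>
    simp only [free_comp, free_gen]
    exact congr_app (μ_natural_left F.toFunctor f a') b
  | gamma_naturality_middle a f b =>
    simp only [free_comp, free_gen]
    exact congr_app (μ_natural_right F.toFunctor a f) b
  | gamma_naturality_right a a' g =>
    simp only [free_comp, free_gen, free_genTensor]
    exact (nat (μ F.toFunctor a a')).naturality g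
  | delta_naturality_left f b b' =>
    simp only [free_comp, free_gen, free_genTensor]
    exact (hom_tensor (F.map f) b b').symm
  | delta_naturality_middle a g b' =>
    simp only [free_comp, free_gen]
    exact μ_natural_left (F.obj a).toFunctor g b'
  | delta_naturality_right a b g =>
    simp only [free_comp, free_gen]
    exact μ_natural_right (F.obj a).toFunctor b g
  | delta_assoc a b b' b'' =>
    simp only [free_comp, free_gen]
    exact (associativity_inv (F.obj a).toFunctor b b' b'').symm
  | delta_r a b =>
    simp only [free_comp, free_gen]
    exact right_unitality (F.obj a).toFunctor b
  | delta_l a b =>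
    simp only [free_comp, free_gen]
    exact left_unitality (F.obj a).toFunctor b
  | delta_s a b b' =>
    simp only [free_comp, free_gen]
    exact Functor.LaxBraided.braided (F := (F.obj a).toFunctor) b b'
  | gamma_assoc a a' a'' b =>
    simp only [free_comp, free_gen]
    exact (congr_app (associativity_inv F.toFunctor a a' a'') b).symm
  | gamma_r a b =>
    simp only [free_comp, free_gen]
    exact congr_app (right_unitality F.toFunctor a) b
  | gamma_l a b =>
    simp only [free_comp, free_gen]
    exact congr_app (left_unitality F.toFunctor a) b
  | gamma_s a a' b =>
    simp only [free_comp, free_gen]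
    exact congr_app (Functor.LaxBraided.braided (F := F.toFunctor) a a') b
  | alpha_tensor b b' =>
    simp only [free_comp, free_gen, free_genTensor]
    exact (hom_tensor (ε F.toFunctor) b b').symm
  | beta_tensor a a' =>
    simp only [free_comp, free_gen, free_genTensor]
    exact comp_eq_of_inv_comp_comp (λ_ (𝟙_ C)) (hom_unit (μ F.toFunctor a a'))
  | beta_alpha =>
    simp only [free_gen]
    exact (hom_unit (ε F.toFunctor)).symm.trans (Category.id_comp _)
  | delta_gamma a a' b b' =>
    simp only [free_comp, free_gen, free_genTensor]
    exact comp_eq_of_tensorμ_comp_comp (hom_tensor (μ F.toFunctor a a') b b')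

/-- The functor underlying `En(F)`. -/
def functor (F : LaxBraidedFunctor A (LaxBraidedFunctor B C)) : TensorCat A B ⥤ C :=
  CategoryTheory.Quotient.lift Rel (free F) fun _ _ _ _ h => free_rel F h

lemma functor_edge (F : LaxBraidedFunctor A (LaxBraidedFunctor B C)) {X Y : TensorObj A B}
    (p : Edge X Y) : (functor F).map (TensorCat.edge p) = edgeMap F p := free_gen F p

lemma functor_whiskerLeft (F : LaxBraidedFunctor A (LaxBraidedFunctor B C)) (X : TensorCat A B)
    {Y Z : TensorCat A B} (f : Y ⟶ Z) :
    (functor F).map (X ◁ f) = obj F X.as ◁ (functor F).map f := by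
  obtain ⟨p, rfl⟩ := (CategoryTheory.Quotient.functor (Rel (A := A) (B := B))).map_surjective
    (X := Y.as) (Y := Z.as) f
  exact free_whiskerLeft F X.as p

lemma functor_whiskerRight (F : LaxBraidedFunctor A (LaxBraidedFunctor B C))
    {Y Z : TensorCat A B} (f : Y ⟶ Z) (X : TensorCat A B) :
    (functor F).map (f ▷ X) = (functor F).map f ▷ obj F X.as := by
  obtain ⟨p, rfl⟩ := (CategoryTheory.Quotient.functor (Rel (A := A) (B := B))).map_surjective
    (X := Y.as) (Y := Z.as) f
  exact free_whiskerRight F p X.as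

end En

/-- The strict symmetric monoidal functor `En(F) : A ⊗ B ⥤ C` of a symmetric monoidal functor
`F : A ⥤ [B, C]`. -/
def enObj (F : LaxBraidedFunctor A (LaxBraidedFunctor B C)) :
    LaxBraidedFunctor (TensorCat A B) C where
  toFunctor := En.functor F
  laxBraided :=
    { ε := 𝟙 (𝟙_ C)
      μ := fun X Y => 𝟙 (En.obj F X.as ⊗ En.obj F Y.as)
      μ_natural_left := fun f X => (Category.comp_id _).trans
        ((En.functor_whiskerRight F f X).symm.trans (Category.id_comp _).symm)
      μ_natural_right := fun X f => (Category.comp_id _).trans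
        ((En.functor_whiskerLeft F X f).symm.trans (Category.id_comp _).symm)
      associativity := fun X Y Z =>
        strict_assoc (En.functor_edge F (.acInv X.as Y.as Z.as))
      left_unitality := fun X => strict_left (En.functor_edge F (.l X.as))
      right_unitality := fun X => strict_right (En.functor_edge F (.r X.as))
      braided := fun X Y => strict_braided (En.functor_edge F (.s X.as Y.as)) }

namespace En

/-- The components of `En(σ)`. -/
def app {F G : LaxBraidedFunctor A (LaxBraidedFunctor B C)} (σ : F ⟶ G) :
    ∀ X : TensorObj A B, obj F X ⟶ obj G X
  | .unit => 𝟙 (𝟙_ C)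
  | .pair a b => (nat ((nat σ).app a)).app b
  | .tensor X Y => app σ X ⊗ₘ app σ Y

lemma app_naturality {F G : LaxBraidedFunctor A (LaxBraidedFunctor B C)} (σ : F ⟶ G)
    {X Y : TensorObj A B} (p : Edge X Y) :
    edgeMap F p ≫ app σ Y = app σ X ≫ edgeMap G p := by
  induction p with
  | ac X Y Z => exact (associator_inv_naturality _ _ _).symm
  | acInv X Y Z => exact (associator_naturality _ _ _).symm
  | l X =>
    change _ = (𝟙 (𝟙_ C) ⊗ₘ _) ≫ _
    rw [id_tensorHom]
    exact (leftUnitor_naturality _).symm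
  | lInv X =>
    change _ ≫ (𝟙 (𝟙_ C) ⊗ₘ _) = _
    rw [id_tensorHom]
    exact (leftUnitor_inv_naturality _).symm
  | r X =>
    change _ = (_ ⊗ₘ 𝟙 (𝟙_ C)) ≫ _
    rw [tensorHom_id]
    exact (rightUnitor_naturality _).symm
  | rInv X =>
    change _ ≫ (_ ⊗ₘ 𝟙 (𝟙_ C)) = _
    rw [tensorHom_id]
    exact (rightUnitor_inv_naturality _).symm
  | s X Y => exact (BraidedCategory.braiding_naturality _ _).symm
  | alpha b => exact (congr_app (hom_unit σ) b).trans (Category.id_comp _).symm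
  | beta a => exact (hom_unit ((nat σ).app a)).trans (Category.id_comp _).symm
  | gamma a a' b => exact congr_app (hom_tensor σ a a') b
  | delta a b b' => exact hom_tensor ((nat σ).app a) b b'
  | right a g => exact hom_naturality ((nat σ).app a) g
  | left f b => exact congr_app (hom_naturality σ f) b
  | whiskerLeft X p ih =>
    change obj F X ◁ edgeMap F p ≫ (app σ X ⊗ₘ app σ _) =
      (app σ X ⊗ₘ app σ _) ≫ obj G X ◁ edgeMap G p
    rw [← id_tensorHom, ← id_tensorHom, tensorHom_comp_tensorHom, tensorHom_comp_tensorHom, ih,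
      Category.id_comp, Category.comp_id]
  | whiskerRight p X ih =>
    change edgeMap F p ▷ obj F X ≫ (app σ _ ⊗ₘ app σ X) =
      (app σ _ ⊗ₘ app σ X) ≫ edgeMap G p ▷ obj G X
    rw [← tensorHom_id, ← tensorHom_id, tensorHom_comp_tensorHom, tensorHom_comp_tensorHom, ih,
      Category.id_comp, Category.comp_id]

end En

/-- The monoidal transformation `En(σ) : En(F) ⟶ En(G)` of `σ : F ⟶ G`. -/
def enMap {F G : LaxBraidedFunctor A (LaxBraidedFunctor B C)} (σ : F ⟶ G) :
    enObj F ⟶ enObj G :=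
  mkHom (F := enObj F) (G := enObj G) (fun X => En.app σ X.as)
    (fun f => TensorCat.naturality_of_edge (En.functor F) (En.functor G) (En.app σ)
      (fun p => by
        rw [En.functor_edge, En.functor_edge]
        exact En.app_naturality σ p) f)
    (Category.id_comp _)
    (fun X Y => (Category.id_comp _).trans (Category.comp_id _).symm)

end En

section Strict

variable {C : Type u₁} [Category.{v₁} C] [MonoidalCategory C] [SymmetricCategory C]
  {D : Type u₂} [Category.{v₂} D] [MonoidalCategory D] [SymmetricCategory D]

open Functor.LaxMonoidal

/-- A symmetric monoidal functor `F` is strict when its structure arrows `I ⟶ F I` and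
`F X ⊗ F Y ⟶ F (X ⊗ Y)` are all identities. -/
def IsStrict : ObjectProperty (LaxBraidedFunctor C D) := fun F =>
  (∃ h : 𝟙_ D = F.obj (𝟙_ C), ε F.toFunctor = eqToHom h) ∧
    ∀ X Y : C, ∃ h : F.obj X ⊗ F.obj Y = F.obj (X ⊗ Y), μ F.toFunctor X Y = eqToHom h

variable (C D) in
/-- The category `StrSMC(C, D)` of strict symmetric monoidal functors and all the monoidal
transformations between them, a full subcategory of `SMC(C, D)`. -/
abbrev StrSMC := (IsStrict (C := C) (D := D)).FullSubcategory

variable (C D) in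
/-- The inclusion of `StrSMC(C, D)` in `SMC(C, D)`. -/
abbrev strInclusion : StrSMC C D ⥤ LaxBraidedFunctor C D := (IsStrict (C := C) (D := D)).ι

end Strict

end SMC

/-! The category `A ⊗ B` is presented by generators and relations, so a strict symmetric monoidal
functor out of it is the same thing as an assignment on generators respecting the relations, and
this amounts to a symmetric monoidal functor `A ⥤ [B, C]`. The inverse of `En` is restriction along
`η`, namely `K ↦ [B, K] ∘ η`.

One composite is the identity because `En(F)` sends the edges `α`, `β`, `γ`, `δ`, `a ⊗ g`, `f ⊗ b`
to the corresponding data of `F` (`restrict_enObj`). For the other composite, every symmetric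
monoidal `K`, strict or not, receives a monoidal transformation from `En` of its restriction. Its
component is `K⁰` at the unit, an identity at a pair, and at `X ⊗ Y` the tensor of the two earlier
components followed by `K²`. Naturality on the canonical edges (`counitApp_naturality`) rests on the
axioms of a lax symmetric monoidal functor. When `K` is strict all these components are identities,
whence `enObj_restrict`, which is uniqueness.

On 2-cells, the structure arrows of `En(F)` are identities, so the monoidal conditions force a
transformation out of `En(F)` at the unit and at tensors once it is known on pairs
(`enObj_hom_ext`). On pairs it is exactly a 2-cell between functors `A ⥤ [B, C]`, which gives
`restrictMap_eq_iff`, and from it full faithfulness of `En`.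

Equalities of functors are strict, so lax structures over different underlying functors must be
compared. `eq_of_hom` does this uniformly: it suffices to give a monoidal transformation whose
components are all of the form `eqToHom`. -/

namespace SMC

open Functor.LaxMonoidal

/-! ### Lax monoidal structure evaluated on arrows into the values of a functor -/

section Lax

variable {C : Type u₁} [Category.{v₁} C] [MonoidalCategory C]
  {D : Type u₂} [Category.{v₂} D] [MonoidalCategory D]

lemma id_tensorHom_id_comp {X Y Z : D} (f : X ⊗ Y ⟶ Z) : (𝟙 X ⊗ₘ 𝟙 Y) ≫ f = f := by
  rw [id_tensorHom_id, Category.id_comp]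

/-- Inverting two opposite sides of a commuting square. It lets a canonical edge and its formal
inverse share one naturality computation. -/
lemma inv_comp_eq_of_hom_comp_eq {C : Type u₁} [Category.{v₁} C] {D : Type u₂} [Category.{v₂} D]
    {G : C ⥤ D} {P Q : D} {X Y : C} (i : P ≅ Q) (j : X ≅ Y)
    {x : P ⟶ G.obj X} (y : Q ⟶ G.obj Y) (h : i.hom ≫ y = x ≫ G.map j.hom) :
    i.inv ≫ x = y ≫ G.map j.inv := by
  rw [Iso.inv_comp_eq, reassoc_of% h, ← G.map_comp, Iso.hom_inv_id, G.map_id, Category.comp_id]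

variable (G : C ⥤ D) [G.LaxMonoidal] {P P' Q Q' R : D} {X X' Y Y' Z : C}

/-- The arrows `x`, `y`, `z` play the role of components of a comparison into `G`, whose component
at a tensor product is `(x ⊗ₘ y) ≫ μ`. Once they are slid past the associator, what remains is lax
associativity. -/
lemma associator_comp_tensorHom_μ (x : P ⟶ G.obj X) (y : Q ⟶ G.obj Y) (z : R ⟶ G.obj Z) :
    (α_ P Q R).hom ≫ (x ⊗ₘ ((y ⊗ₘ z) ≫ μ G Y Z)) ≫ μ G X (Y ⊗ Z) =
      ((((x ⊗ₘ y) ≫ μ G X Y) ⊗ₘ z) ≫ μ G (X ⊗ Y) Z) ≫ G.map (α_ X Y Z).hom := by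
  -- Pulling the inner `μ` out as a whiskering brings both sides to the form of the associativity
  -- axiom.
  have h₁ : x ⊗ₘ ((y ⊗ₘ z) ≫ μ G Y Z) = (x ⊗ₘ (y ⊗ₘ z)) ≫ G.obj X ◁ μ G Y Z := by
    rw [← id_tensorHom, tensorHom_comp_tensorHom, Category.comp_id]
  have h₂ : ((x ⊗ₘ y) ≫ μ G X Y) ⊗ₘ z = ((x ⊗ₘ y) ⊗ₘ z) ≫ μ G X Y ▷ G.obj Z := by
    rw [← tensorHom_id, tensorHom_comp_tensorHom, Category.comp_id]
  rw [h₁, h₂]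
  simp only [Category.assoc]
  rw [associativity, associator_naturality_assoc]

/-- The comparison at the unit object is `ε`. Sliding `x` past the unitor leaves the lax unit axiom;
as `x` then acts before `ε`, the tensor has to be unfolded in the order of `tensorHom_def'`. -/
lemma leftUnitor_comp_eq_tensorHom_μ (x : P ⟶ G.obj X) :
    (λ_ P).hom ≫ x = ((ε G ⊗ₘ x) ≫ μ G (𝟙_ C) X) ≫ G.map (λ_ X).hom := by
  rw [← leftUnitor_naturality, left_unitality, MonoidalCategory.tensorHom_def']
  simp only [Category.assoc]

lemma rightUnitor_comp_eq_tensorHom_μ (x : P ⟶ G.obj X) :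
    (ρ_ P).hom ≫ x = ((x ⊗ₘ ε G) ≫ μ G X (𝟙_ C)) ≫ G.map (ρ_ X).hom := by
  rw [← rightUnitor_naturality, right_unitality, MonoidalCategory.tensorHom_def]
  simp only [Category.assoc]

/-- Inductive step for whiskered edges: by naturality of `μ`, a naturality square for `p` passes to
`X ◁ p`. -/
lemma whiskerLeft_comp_tensorHom_μ (x : P ⟶ G.obj X) {f : Q ⟶ Q'} {y : Q ⟶ G.obj Y}
    {y' : Q' ⟶ G.obj Y'} (p : Y ⟶ Y') (h : f ≫ y' = y ≫ G.map p) :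
    P ◁ f ≫ (x ⊗ₘ y') ≫ μ G X Y' = ((x ⊗ₘ y) ≫ μ G X Y) ≫ G.map (X ◁ p) := by
  rw [Category.assoc, ← μ_natural_right, ← id_tensorHom, ← id_tensorHom,
    tensorHom_comp_tensorHom_assoc, tensorHom_comp_tensorHom_assoc, h, Category.id_comp,
    Category.comp_id]

lemma whiskerRight_comp_tensorHom_μ {f : P ⟶ P'} {x : P ⟶ G.obj X} {x' : P' ⟶ G.obj X'}
    (p : X ⟶ X') (y : Q ⟶ G.obj Y) (h : f ≫ x' = x ≫ G.map p) :
    f ▷ Q ≫ (x' ⊗ₘ y) ≫ μ G X' Y = ((x ⊗ₘ y) ≫ μ G X Y) ≫ G.map (p ▷ Y) := by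
  rw [Category.assoc, ← μ_natural_left, ← tensorHom_id, ← tensorHom_id,
    tensorHom_comp_tensorHom_assoc, tensorHom_comp_tensorHom_assoc, h, Category.id_comp,
    Category.comp_id]

lemma braiding_comp_tensorHom_μ [BraidedCategory C] [BraidedCategory D] (G : C ⥤ D) [G.LaxBraided]
    (x : P ⟶ G.obj X) (y : Q ⟶ G.obj Y) :
    (β_ P Q).hom ≫ (y ⊗ₘ x) ≫ μ G Y X = ((x ⊗ₘ y) ≫ μ G X Y) ≫ G.map (β_ X Y).hom := by
  rw [Category.assoc, Functor.LaxBraided.braided, BraidedCategory.braiding_naturality_assoc]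

end Lax

/-! ### Equality of symmetric monoidal functors -/

section EqToHom

variable {C : Type u₁} [Category.{v₁} C] [MonoidalCategory C] [SymmetricCategory C]
  {D : Type u₂} [Category.{v₂} D] [MonoidalCategory D] [SymmetricCategory D]

lemma eqToHom_tensorHom_eqToHom {D : Type u₂} [Category.{v₂} D] [MonoidalCategory D]
    {X X' Y Y' : D} (h : X = X') (h' : Y = Y') :
    eqToHom h ⊗ₘ eqToHom h' = eqToHom (congrArg₂ (fun S T => S ⊗ T) h h') := by
  subst h h'
  exact id_tensorHom_id _ _

/-- Transport along an equality of functors is transport in each component. For functors into `[B,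
C]` it is used twice: first at an object of `A`, then at an object of `B`. -/
lemma nat_eqToHom_app {F G : LaxBraidedFunctor C D} (h : F = G) (X : C) :
    (nat (eqToHom h)).app X = eqToHom (congrArg (fun H => H.obj X) h) := by
  subst h
  rfl

/-- Compatibility with the symmetry is a property of a lax monoidal structure, so the only data are
`ε` and `μ`. -/
lemma laxBraided_ext {F : C ⥤ D} (i j : F.LaxBraided)
    (hε : @ε _ _ _ _ _ _ F i.toLaxMonoidal = @ε _ _ _ _ _ _ F j.toLaxMonoidal)
    (hμ : ∀ X Y, @μ _ _ _ _ _ _ F i.toLaxMonoidal X Y = @μ _ _ _ _ _ _ F j.toLaxMonoidal X Y) :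
    i = j := by
  obtain @⟨i, _⟩ := i
  obtain @⟨j, _⟩ := j
  obtain rfl : i = j := Functor.LaxMonoidal.ext hε (funext₂ hμ)
  rfl

/-- Symmetric monoidal functors connected by a monoidal transformation whose components are
identities are equal. -/
lemma eq_of_hom {F G : LaxBraidedFunctor C D} (σ : F ⟶ G)
    (h : ∀ X, ∃ e : F.obj X = G.obj X, (nat σ).app X = eqToHom e) : F = G := by
  -- Naturality of a transformation with `eqToHom` components says that the two functors agree on
  -- arrows up to transport.
  have hFG : F.toFunctor = G.toFunctor := CategoryTheory.Functor.ext (fun X => (h X).1)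
    fun X Y f => by
      have := hom_naturality σ f
      rw [(h X).2, (h Y).2] at this
      rw [← Category.assoc, ← this, Category.assoc, eqToHom_trans, eqToHom_refl, Category.comp_id]
  obtain ⟨F, i⟩ := F
  obtain ⟨G, j⟩ := G
  obtain rfl : F = G := hFG
  -- With the underlying functors identified, each `eqToHom` has equal endpoints and is an identity.
  -- The unit and tensor conditions on `σ` then become equality of the structure arrows.
  have happ : ∀ X, (nat σ).app X = 𝟙 (F.obj X) := fun X => (h X).2
  congr 1
  refine laxBraided_ext i j ?_ fun X Y => ?_
  · have := hom_unit σ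
    rw [happ] at this
    exact (Category.comp_id _).symm.trans this
  · have := hom_tensor σ X Y
    rw [happ, happ, happ] at this
    refine (Category.comp_id _).symm.trans (this.trans ?_)
    rw [id_tensorHom_id]
    exact Category.id_comp _

end EqToHom

variable {A : Type u₁} [Category.{v₁} A] [MonoidalCategory A] [SymmetricCategory A]
  {B : Type u₂} [Category.{v₂} B] [MonoidalCategory B] [SymmetricCategory B]
  {C : Type u₃} [Category.{v₃} C] [MonoidalCategory C] [SymmetricCategory C]

/-! ### Restriction along `η` -/

/-- Restriction of symmetric monoidal functors `A ⊗ B ⥤ C` along `η`. -/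
abbrev restrict (K : LaxBraidedFunctor (TensorCat A B) C) :
    LaxBraidedFunctor A (LaxBraidedFunctor B C) :=
  compSMC (eta A B) (post B K)

/-- Restriction of monoidal transformations along `η`. -/
abbrev restrictMap {K L : LaxBraidedFunctor (TensorCat A B) C} (τ : K ⟶ L) :
    restrict K ⟶ restrict L :=
  whiskerLeftSMC (eta A B) (postMap B τ)

lemma isStrict_enObj (F : LaxBraidedFunctor A (LaxBraidedFunctor B C)) : IsStrict (enObj F) :=
  ⟨⟨rfl, rfl⟩, fun _ _ => ⟨rfl, rfl⟩⟩

/-! ### The restriction of `En(F)` is `F` -/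

section RestrictEn

variable (F : LaxBraidedFunctor A (LaxBraidedFunctor B C))

lemma enObj_map_edge {X Y : TensorObj A B} (p : Edge X Y) :
    (enObj F).map (TensorCat.edge p) = En.edgeMap F p := En.functor_edge F p

/-- The identity transformation from the restriction of `En(F)` to `F` at an object of `A`. -/
def restrictEnApp (a : A) : (restrict (enObj F)).obj a ⟶ F.obj a :=
  mkHom (F := (restrict (enObj F)).obj a) (G := F.obj a) (fun b => 𝟙 ((F.obj a).obj b))
    (fun g => (Category.comp_id _).trans
      ((enObj_map_edge F (.right a g)).trans (Category.id_comp _).symm))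
    -- The unit arrow of the composite is that of `En(F)`, an identity, followed by the image of
    -- `β_a`; likewise for the tensor arrow and `δ`.
    ((Category.comp_id _).trans ((Category.id_comp _).trans (enObj_map_edge F (.beta a))))
    (fun b b' => (Category.comp_id _).trans (((Category.id_comp _).trans
      (enObj_map_edge F (.delta a b b'))).trans (id_tensorHom_id_comp _).symm))

/-- The identity transformation from the restriction of `En(F)` to `F`. -/
def restrictEnHom : restrict (enObj F) ⟶ F :=
  mkHom (restrictEnApp F)
    (fun f => hom_ext_app fun b => (Category.comp_id _).trans
      ((enObj_map_edge F (.left f b)).trans (Category.id_comp _).symm))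
    (hom_ext_app fun b => (Category.comp_id _).trans
      ((Category.id_comp _).trans (enObj_map_edge F (.alpha b))))
    (fun a a' => hom_ext_app fun b => (Category.comp_id _).trans (((Category.id_comp _).trans
      (enObj_map_edge F (.gamma a a' b))).trans (id_tensorHom_id_comp _).symm))

/-- The comparison is an identity at each `a` and `b`. The criterion `eq_of_hom` is applied at two
levels: inside `[B, C]` for each `a`, to obtain equality of objects, and then for functors out of
`A`. -/
lemma restrict_enObj : restrict (enObj F) = F :=
  eq_of_hom (restrictEnHom F) fun a =>
    have h : (restrict (enObj F)).obj a = F.obj a :=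
      eq_of_hom (restrictEnApp F a) fun _ => ⟨rfl, rfl⟩
    -- The outer level asks for `eqToHom h` as an arrow of `[B, C]`; at `b` it is a transport
    -- between definitionally equal objects, hence the identity.
    ⟨h, hom_ext_app fun b => (nat_eqToHom_app h b).symm⟩

end RestrictEn

/-! ### Monoidal transformations out of `En(F)` -/

/-- Induction on terms: since `ε` and `μ` of `En(F)` are identities, the monoidal conditions express
the component at the unit as `ε` of `L`, and the one at a tensor through the two factors and `μ` of
`L`. The target `L` may be merely lax. -/
lemma enObj_hom_ext {F : LaxBraidedFunctor A (LaxBraidedFunctor B C)}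
    {L : LaxBraidedFunctor (TensorCat A B) C} {τ τ' : enObj F ⟶ L}
    (h : ∀ a b, (nat τ).app (TensorCat.mk (.pair a b)) = (nat τ').app (TensorCat.mk (.pair a b))) :
    τ = τ' := by
  refine hom_ext_app fun ⟨X⟩ => ?_
  induction X with
  | unit =>
    exact (Category.id_comp _).symm.trans
      ((hom_unit τ).trans ((hom_unit τ').symm.trans (Category.id_comp _)))
  | pair a b => exact h a b
  | tensor X Y hX hY =>
    have e := hom_tensor τ (TensorCat.mk X) (TensorCat.mk Y)
    have e' := hom_tensor τ' (TensorCat.mk X) (TensorCat.mk Y)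
    rw [hX, hY] at e
    exact (Category.id_comp _).symm.trans (e.trans (e'.symm.trans (Category.id_comp _)))

/-- Both equations say that `τ` at the pair `(a, b)` is `(σ_a)_b`. The transports are needed because
the restriction of `En(F)` equals `F` only propositionally. -/
lemma restrictMap_eq_iff {F G : LaxBraidedFunctor A (LaxBraidedFunctor B C)} (σ : F ⟶ G)
    (τ : enObj F ⟶ enObj G) :
    restrictMap τ = eqToHom (restrict_enObj F) ≫ σ ≫ eqToHom (restrict_enObj G).symm ↔
      τ = enMap σ := by
  have key : ∀ a b, (nat ((nat (eqToHom (restrict_enObj F) ≫ σ ≫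
      eqToHom (restrict_enObj G).symm)).app a)).app b =
        (nat (enMap σ)).app (TensorCat.mk (.pair a b)) := fun a b => by
    change (nat ((nat (eqToHom (restrict_enObj F))).app a)).app b ≫ (nat ((nat σ).app a)).app b ≫
      (nat ((nat (eqToHom (restrict_enObj G).symm)).app a)).app b = _
    -- Two transports, each evaluated first in `A` and then in `B`; the results join definitionally
    -- equal objects, so they reduce to identities.
    rw [nat_eqToHom_app, nat_eqToHom_app, nat_eqToHom_app, nat_eqToHom_app]
    exact (Category.id_comp _).trans (Category.comp_id _)
  constructor
  · intro h
    refine enObj_hom_ext fun a b => ?_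
    rw [← key, ← h]
    rfl
  · rintro rfl
    refine hom_ext_app fun a => hom_ext_app fun b => ?_
    rw [key]
    rfl

lemma enMap_id (F : LaxBraidedFunctor A (LaxBraidedFunctor B C)) :
    enMap (𝟙 F) = 𝟙 (enObj F) :=
  enObj_hom_ext fun _ _ => rfl

lemma enMap_comp {F G H : LaxBraidedFunctor A (LaxBraidedFunctor B C)} (σ : F ⟶ G) (τ : G ⟶ H) :
    enMap (σ ≫ τ) = enMap σ ≫ enMap τ :=
  enObj_hom_ext fun _ _ => rfl

/-! ### Comparison of `K` with `En` of its restriction -/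

section Counit

variable (K : LaxBraidedFunctor (TensorCat A B) C)

/-- The components of the comparison from `En` of the restriction of `K` to `K`. -/
def counitApp : ∀ X : TensorObj A B, En.obj (restrict K) X ⟶ K.obj (TensorCat.mk X)
  | .unit => ε K.toFunctor
  | .pair a b => 𝟙 (K.obj (TensorCat.mk (.pair a b)))
  | .tensor X Y => (counitApp X ⊗ₘ counitApp Y) ≫ μ K.toFunctor (TensorCat.mk X) (TensorCat.mk Y)

/-- No strictness of `K` is needed: associativity, unit and symmetry axioms of `K` settle the
canonical edges, the naturality of its `μ` settles the whiskered ones, and the remaining edges hold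
by the definition of the restriction. -/
lemma counitApp_naturality {X Y : TensorObj A B} (p : Edge X Y) :
    En.edgeMap (restrict K) p ≫ counitApp K Y = counitApp K X ≫ K.map (TensorCat.edge p) := by
  induction p with
  | ac X Y Z =>
    exact inv_comp_eq_of_hom_comp_eq (α_ _ _ _)
      (α_ (TensorCat.mk X) (TensorCat.mk Y) (TensorCat.mk Z)) _
      (associator_comp_tensorHom_μ K.toFunctor _ _ _)
  | acInv X Y Z => exact associator_comp_tensorHom_μ K.toFunctor _ _ _
  | l X => exact leftUnitor_comp_eq_tensorHom_μ K.toFunctor _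
  | lInv X =>
    exact inv_comp_eq_of_hom_comp_eq (λ_ _) (λ_ (TensorCat.mk X)) _
      (leftUnitor_comp_eq_tensorHom_μ K.toFunctor _)
  | r X => exact rightUnitor_comp_eq_tensorHom_μ K.toFunctor _
  | rInv X =>
    exact inv_comp_eq_of_hom_comp_eq (ρ_ _) (ρ_ (TensorCat.mk X)) _
      (rightUnitor_comp_eq_tensorHom_μ K.toFunctor _)
  | s X Y => exact braiding_comp_tensorHom_μ K.toFunctor _ _
  -- For `α`, `β`, `γ`, `δ`, the structure arrow of the restriction is by definition the `ε` or `μ`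
  -- of `K` followed by the image of the edge, which is the right-hand side up to identities.
  | alpha b => exact Category.comp_id _
  | beta a => exact Category.comp_id _
  | gamma a a' b =>
    exact (Category.comp_id _).trans
      ((id_tensorHom_id_comp _).symm.trans (Category.assoc _ _ _).symm)
  | delta a b b' =>
    exact (Category.comp_id _).trans
      ((id_tensorHom_id_comp _).symm.trans (Category.assoc _ _ _).symm)
  | right a g => exact (Category.comp_id _).trans (Category.id_comp _).symm
  | left f b => exact (Category.comp_id _).trans (Category.id_comp _).symm
  | whiskerLeft X p ih =>
    rw [← TensorCat.whiskerLeft_edge]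
    exact whiskerLeft_comp_tensorHom_μ K.toFunctor _ _ ih
  | whiskerRight p X ih =>
    rw [← TensorCat.whiskerRight_edge]
    exact whiskerRight_comp_tensorHom_μ K.toFunctor _ _ ih

/-- The comparison from `En` of the restriction of `K` to `K`. -/
def counitHom : enObj (restrict K) ⟶ K :=
  mkHom (F := enObj (restrict K)) (G := K) (fun X => counitApp K X.as)
    (fun f => TensorCat.naturality_of_edge (En.functor (restrict K)) K.toFunctor (counitApp K)
      (fun p => by
        rw [En.functor_edge]
        exact counitApp_naturality K p) f)
    -- The structure arrows of `En` being identities, both monoidal conditions are the recursive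
    -- clauses defining the components.
    (Category.id_comp _)
    (fun _ _ => Category.id_comp _)

variable {K}

/-- The components are built by tensoring and composing the structure arrows of `K` and identities,
so for strict `K` they never leave the class of `eqToHom` arrows. -/
lemma counitApp_eq_eqToHom (hK : IsStrict K) (X : TensorObj A B) :
    ∃ e : En.obj (restrict K) X = K.obj (TensorCat.mk X), counitApp K X = eqToHom e := by
  induction X with
  | unit => exact hK.1
  | pair a b => exact ⟨rfl, rfl⟩
  | tensor X Y hX hY =>
    obtain ⟨eX, hX⟩ := hX
    obtain ⟨eY, hY⟩ := hY
    obtain ⟨e, h⟩ := hK.2 (TensorCat.mk X) (TensorCat.mk Y)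
    refine ⟨(congrArg₂ (fun S T => S ⊗ T) eX eY).trans e, ?_⟩
    rw [counitApp, hX, hY, h, eqToHom_tensorHom_eqToHom]
    exact eqToHom_trans _ _

lemma enObj_restrict (hK : IsStrict K) : enObj (restrict K) = K :=
  eq_of_hom (counitHom K) fun X => counitApp_eq_eqToHom hK X.as

end Counit

/-! ### `En` as an isomorphism onto the strict functors -/

variable (A B C) in
/-- The functor `En`. -/
abbrev en : LaxBraidedFunctor A (LaxBraidedFunctor B C) ⥤ LaxBraidedFunctor (TensorCat A B) C where
  obj := enObj
  map := enMap
  map_id := enMap_id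
  map_comp := enMap_comp

/-- By `restrictMap_eq_iff`, the restriction of `enMap σ` is `σ` conjugated by isomorphisms, so `σ`
can be recovered from `enMap σ`. -/
instance : (en A B C).Faithful where
  map_injective {F G σ σ'} h := by
    have e := (restrictMap_eq_iff σ (enMap σ)).2 rfl
    have e' := (restrictMap_eq_iff σ' (enMap σ)).2 h
    rw [e] at e'
    exact (cancel_mono _).1 ((cancel_epi _).1 e')

instance : (en A B C).Full where
  map_surjective {F G} τ :=
    -- The preimage is the restriction of `τ`, transported back to an arrow `F ⟶ G`.
    ⟨eqToHom (restrict_enObj F).symm ≫ restrictMap τ ≫ eqToHom (restrict_enObj G),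
      ((restrictMap_eq_iff _ τ).1 (by simp)).symm⟩

variable (A B C) in
/-- The functor `En` with values in strict symmetric monoidal functors. -/
abbrev enStrict : LaxBraidedFunctor A (LaxBraidedFunctor B C) ⥤ StrSMC (TensorCat A B) C :=
  ObjectProperty.lift _ (en A B C) isStrict_enObj

/-- On objects the inverse is restriction along `η`; strictness enters only in showing that it is a
right inverse of `En`. -/
instance : (enStrict A B C).IsIso where
  bijective_obj := by
    refine Function.bijective_iff_has_inverse.2 ⟨fun K => restrict K.obj, restrict_enObj, ?_⟩
    rintro ⟨K, hK⟩
    exact ObjectProperty.FullSubcategory.ext (enObj_restrict hK)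

end SMC

theorem mainTheorem4 {A : Type u₁} [Category.{v₁} A] [MonoidalCategory A] [SymmetricCategory A]
    {B : Type u₂} [Category.{v₂} B] [MonoidalCategory B] [SymmetricCategory B]
    {C : Type u₃} [Category.{v₃} C] [MonoidalCategory C] [SymmetricCategory C] :
    (∀ F : LaxBraidedFunctor A (LaxBraidedFunctor B C),
      SMC.IsStrict (SMC.enObj F) ∧
      SMC.compSMC (SMC.eta A B) (SMC.post B (SMC.enObj F)) = F ∧
      ∀ K : LaxBraidedFunctor (SMC.TensorCat A B) C, SMC.IsStrict K →
        SMC.compSMC (SMC.eta A B) (SMC.post B K) = F → K = SMC.enObj F) ∧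
    (∃ hη : ∀ F : LaxBraidedFunctor A (LaxBraidedFunctor B C),
        SMC.compSMC (SMC.eta A B) (SMC.post B (SMC.enObj F)) = F,
      ∀ (F G : LaxBraidedFunctor A (LaxBraidedFunctor B C)) (σ : F ⟶ G)
        (τ : SMC.enObj F ⟶ SMC.enObj G),
        SMC.whiskerLeftSMC (SMC.eta A B) (SMC.postMap B τ) =
            eqToHom (hη F) ≫ σ ≫ eqToHom (hη G).symm ↔
          τ = SMC.enMap σ) ∧
    ∃ (map_id : ∀ F : LaxBraidedFunctor A (LaxBraidedFunctor B C),
        SMC.enMap (𝟙 F) = 𝟙 (SMC.enObj F))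
      (map_comp : ∀ {F G H : LaxBraidedFunctor A (LaxBraidedFunctor B C)} (σ : F ⟶ G)
        (τ : G ⟶ H), SMC.enMap (σ ≫ τ) = SMC.enMap σ ≫ SMC.enMap τ)
      (e : IsoCat (LaxBraidedFunctor A (LaxBraidedFunctor B C))
        (SMC.StrSMC (SMC.TensorCat A B) C)),
      ({ obj := SMC.enObj, map := SMC.enMap, map_id := map_id, map_comp := map_comp } :
          LaxBraidedFunctor A (LaxBraidedFunctor B C) ⥤
            LaxBraidedFunctor (SMC.TensorCat A B) C) =
        e.functor ⋙ SMC.strInclusion (SMC.TensorCat A B) C :=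
  ⟨fun F => ⟨SMC.isStrict_enObj F, SMC.restrict_enObj F, by
      -- Replacing `F` by the restriction of `K` turns uniqueness into `enObj_restrict`.
      rintro K hK rfl
      exact (SMC.enObj_restrict hK).symm⟩,
    ⟨SMC.restrict_enObj, fun _ _ => SMC.restrictMap_eq_iff⟩,
    SMC.enMap_id, SMC.enMap_comp, (SMC.enStrict A B C).asIsomorphism, rfl⟩
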